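/- Let $m\ge 1$. For $n\ge 1$ let $X=(x_1,\dots,x_n)$ and let $G_{n,m}=S_n\wr\mathbb Z_m$ be the group of complex $n\times n$ matrices having exactly one nonzero entry in each row and each column, all nonzero entries being $m$-th roots of unity. For a subset $A\subset X$ of $l$ variables and $K=(k_1,\dots,k_l)$ with all $k_i>0$, the matrix $g\in G_{n,m}$ acts on the monomial $A^K$ (variables of $A$ in increasing order) by $$g\bullet A^K=w(g)^{c(K)}\,\bigl((A\cdot{}^t|g|)_<\bigr)^K,$$ extended linearly to $\mathbb C[X]$. Here $w(g)$ is the product of the nonzero entries of $g$, $A\cdot{}^t|g|$ is obtained from $A$ by replacing each $x_i$ by the $x_j$ with $g_{ij}\neq 0$, $(\cdot)_<$ means that the variables are put in increasing order, and $c(K)=0$ if $m$ divides all $k_i$, $c(K)=1$ otherwise. Let $QInv_{n,m}^+$ be the set of polynomials without constant term that are fixed by all $g\in G_{n,m}$ under $\bullet$, and let $$SCov_{n,m}=\{P\in\mathbb C[X] : Q(\partial X)P=0\ \text{ for all } Q\in QInv_{n,m}^+\},$$ where $Q(\partial X)=Q(\partial/\partial x_1,\dots,\partial/\partial x_n)$.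 Let $SCov_{n,m}^{(k)}$ be the space of elements of $SCov_{n,m}$ that are homogeneous of degree $k$ (or zero), and let $F_{n,m}(t)=\sum_{k\ge 0}\dim_{\mathbb C} SCov_{n,m}^{(k)}\,t^k$. Then for all $n\ge 1$, with $F_n(t)=\sum_{k=0}^{n-1}\frac{n-k}{n+k}\binom{n+k}{k}t^k$, $$F_{n,m}(t)=\Bigl(\frac{1-t^m}{1-t}\Bigr)^{n}F_n(t^m)=\Bigl(\frac{1-t^m}{1-t}\Bigr)^{n}\sum_{k=0}^{n-1}\frac{n-k}{n+k}\binom{n+k}{k}t^{mk}.$$ Moreover, as formal power series in $x$ with coefficients in $\mathbb Q[[t]]$, $$\sum_{n\ge 1}F_{n,m}(t)\,x^n=\frac{(1-t)-\sqrt{(1-t)\bigl(1-t-4t^m x(1-t^m)\bigr)}-2x(1-t^m)}{2\bigl((1-t)(t^m-1)+x(1-t^m)\bigr)},$$ where the square root is the unique one with constant term $1$ and the denominator is invertible. -/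

import Mathlib

open scoped Polynomial PowerSeries

noncomputable section

namespace QuasiInv

/-- The generalized symmetric group `S_n ≀ ℤ_m`, as a set of complex `n × n` matrices: every row
and every column has exactly one nonzero entry, and every nonzero entry is an `m`-th root of
unity. -/
def genSymGroup (n m : ℕ) : Set (Matrix (Fin n) (Fin n) ℂ) :=
  {g | (∀ i, ∃! j, g i j ≠ 0) ∧ (∀ j, ∃! i, g i j ≠ 0) ∧ ∀ i j, g i j ≠ 0 → g i j ^ m = 1}

open Classical in
/-- The weight `w(g)`: the product of the nonzero entries of `g`. -/
def weight {n : ℕ} (g : Matrix (Fin n) (Fin n) ℂ) : ℂ :=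
  ∏ i, ∏ j, if g i j = 0 then 1 else g i j

/-- For an exponent vector `ν`, the monomial `X^ν` is `A^K` where `A` is the set of variables
occurring in it and `K` is the list of nonzero entries of `ν`, read from left to right. This is
the list `K`. -/
def expList {n : ℕ} (ν : Fin n →₀ ℕ) : List ℕ := (ν.support.sort (· ≤ ·)).map ν

open Classical in
/-- The exponent `c(K)`: it is `0` if all entries of `K` are divisible by `m`, and `1` if not. -/
def cExp (m : ℕ) (K : List ℕ) : ℕ := if ∀ k ∈ K, m ∣ k then 0 else 1

open Classical in
/-- The variables occurring in the vector `A · ᵗ|g|`: the variable `x_i` is replaced by the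
variable `x_j` with `g i j ≠ 0`. -/
def imageVars {n : ℕ} (g : Matrix (Fin n) (Fin n) ℂ) (A : Finset (Fin n)) : Finset (Fin n) :=
  Finset.univ.filter fun j => ∃ i ∈ A, g i j ≠ 0

/-- The exponent vector of the monomial `B_<^K`, where `B_<` consists of the variables in `B` in
increasing order: `x_j` with `j ∈ B` gets the entry of `K` whose (zero-based) position is the
number of elements of `B` smaller than `j`. -/
def placeExp {n : ℕ} (B : Finset (Fin n)) (K : List ℕ) : Fin n →₀ ℕ :=
  Finsupp.equivFunOnFinite.symm fun j =>
    if j ∈ B then K.getD (B.filter (· < j)).card 0 else 0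

/-- The quasi-symmetrizing action of a matrix `g` on polynomials: the linear map with
`g • A^K = w(g)^{c(K)} ((A · ᵗ|g|)_<)^K` on monomials. -/
def quasiAct {n : ℕ} (m : ℕ) (g : Matrix (Fin n) (Fin n) ℂ) :
    MvPolynomial (Fin n) ℂ →ₗ[ℂ] MvPolynomial (Fin n) ℂ :=
  (MvPolynomial.basisMonomials (Fin n) ℂ).constr ℂ fun ν =>
    MvPolynomial.monomial (placeExp (imageVars g ν.support) (expList ν))
      (weight g ^ cExp m (expList ν))

/-- The quasi-invariant polynomials. -/
def QInv (n m : ℕ) : Set (MvPolynomial (Fin n) ℂ) :=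
  {P | ∀ g ∈ genSymGroup n m, quasiAct m g P = P}

/-- The quasi-invariant polynomials without constant term. -/
def QInvPlus (n m : ℕ) : Set (MvPolynomial (Fin n) ℂ) :=
  {P | P ∈ QInv n m ∧ MvPolynomial.constantCoeff P = 0}

/-- The differential operator `Q(∂X)`: the linear extension in `Q` of
`X^ν ↦ ∂x_1^{ν_1} ⋯ ∂x_n^{ν_n}`. -/
def diffOp {n : ℕ} :
    MvPolynomial (Fin n) ℂ →ₗ[ℂ] Module.End ℂ (MvPolynomial (Fin n) ℂ) :=
  (MvPolynomial.basisMonomials (Fin n) ℂ).constr ℂ fun ν =>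
    (List.ofFn fun i : Fin n =>
      ((MvPolynomial.pderiv (R := ℂ) i).toLinearMap :
        Module.End ℂ (MvPolynomial (Fin n) ℂ)) ^ ν i).prod

/-- The space of super-coinvariant polynomials. -/
def SCov (n m : ℕ) : Submodule ℂ (MvPolynomial (Fin n) ℂ) where
  carrier := {P | ∀ Q ∈ QInvPlus n m, diffOp Q P = 0}
  add_mem' := by
    intro P R hP hR Q hQ
    rw [map_add, hP Q hQ, hR Q hQ, add_zero]
  zero_mem' := fun Q _ => map_zero (diffOp Q)
  smul_mem' := by
    intro a P hP Q hQ
    rw [map_smul, hP Q hQ, smul_zero]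

/-- The Hilbert series `F_{n,m}(t) = ∑_k dim SCov_{n,m}^{(k)} t^k`, where `SCov_{n,m}^{(k)}`
consists of the elements of `SCov_{n,m}` that are homogeneous of degree `k`. -/
def hilbertSeries (n m : ℕ) : ℚ⟦X⟧ :=
  PowerSeries.mk fun k =>
    (Module.finrank ℂ
      (SCov n m ⊓ MvPolynomial.homogeneousSubmodule (Fin n) ℂ k :
        Submodule ℂ (MvPolynomial (Fin n) ℂ)) : ℚ)

/-- The polynomial `F_n(t) = ∑_{k=0}^{n-1} (n-k)/(n+k) * binom(n+k,k) * t^k`. -/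
def F (n : ℕ) : ℚ[X] :=
  ∑ k ∈ Finset.range n,
    Polynomial.C (((n : ℚ) - k) / ((n : ℚ) + k) * ((n + k).choose k : ℚ)) * Polynomial.X ^ k

/-- The generating function `∑_{n ≥ 1} F_{n,m}(t) x^n`, a power series in `x` whose coefficients
are power series in `t`. -/
def genFun (m : ℕ) : ℚ⟦X⟧⟦X⟧ :=
  PowerSeries.mk fun n => if n = 0 then 0 else hilbertSeries n m

/-- The variable `t` in the ring of power series in `x` over the power series in `t`. -/
def t : ℚ⟦X⟧⟦X⟧ := PowerSeries.C PowerSeries.X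

/-- The variable `x` in the ring of power series in `x` over the power series in `t`. -/
def x : ℚ⟦X⟧⟦X⟧ := PowerSeries.X

/-- `S` is the square root of the power series `A` in `t` and `x` that has constant term `1`. -/
def IsSqrt (S A : ℚ⟦X⟧⟦X⟧) : Prop :=
  S ^ 2 = A ∧ PowerSeries.constantCoeff (PowerSeries.constantCoeff S) = 1

end QuasiInv

end

noncomputable section

namespace QuasiInv

/-! ### Exponent vectors and their lists of nonzero entries -/

/-! Permutation matrices force the coefficients of a quasi-invariant to depend only on the list of
nonzero exponents (quasi-symmetry), and a diagonal matrix with a single entry a primitive `m`-th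
root of unity kills every monomial having an exponent not divisible by `m`. Hence the
quasi-invariants are exactly the `g(X^m)` with `g` quasi-symmetric (`mem_QInvPlus_iff`).

For `m = 1`, the ballot monomials (partial sums `ν_0 + ⋯ + ν_l ≤ l`) form a basis modulo the ideal
generated by `QSymPlus`. They span because the fundamental quasi-symmetric polynomials give
rewriting rules that lower the power of the first variable (`fundIdeal_sup_ballotSpan`). They are
independent by induction on `n`, using the operators `f ↦ (f|_{x_{i+1}=0} - f|_{x_i=0}) / x_i`, with
the remaining variables renumbered. These kill quasi-symmetric polynomials and map both the ideal
and the ballot span to their analogues in one variable fewer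
(`eq_zero_of_mem_span_QSymPlus_of_mem_ballotSpan`).

For general `m`, `ℂ[X]` is free over `ℂ[X^m]` on the monomials `X^r` with all `r_i < m`, so the
monomials `X^(r + mκ)` with `κ` ballot form a basis modulo the quasi-invariant ideal
(`isCompl_span_QInvPlus_ballotSpanDiv`).

Super-coinvariants are the orthogonal space of this homogeneous ideal for the pairing `⟨P, X^ν⟩ = ν!
[X^ν] P`, so their dimension in degree `k` counts such exponents. The remainders `r` contribute
`((1-t^m)/(1-t))^n` and the ballot vectors `κ` contribute the ballot numbers at `t^m`. The
generating function follows from a recursion of the ballot polynomials in `n` with Catalan numbers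
on the right-hand side (`sum_ballotNumber_recursion`) and the quadratic equation of the Catalan
series. -/

theorem expList_eq_filter {n : ℕ} (ν : Fin n →₀ ℕ) :
    expList ν = (List.ofFn ν).filter (· ≠ 0) := by
  have h : ν.support.sort (· ≤ ·) = (List.finRange n).filter (fun i => ν i ≠ 0) := by
    apply List.Perm.eq_of_sortedLE (Finset.sortedLT_sort _).sortedLE
    · exact List.Pairwise.sortedLE (((List.pairwise_le_finRange n)).filter _)
    · rw [List.perm_ext_iff_of_nodup (Finset.sort_nodup _ _) ((List.nodup_finRange n).filter _)]
      simp
  rw [expList, h, List.ofFn_eq_map, List.filter_map]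
  rfl

theorem expList_zero {n : ℕ} : expList (0 : Fin n →₀ ℕ) = [] := by simp [expList]

theorem length_expList {n : ℕ} (ν : Fin n →₀ ℕ) : (expList ν).length = ν.support.card := by
  simp [expList]

theorem mem_expList {n : ℕ} {ν : Fin n →₀ ℕ} {k : ℕ} :
    k ∈ expList ν ↔ ∃ i, ν i ≠ 0 ∧ ν i = k := by simp [expList]

theorem sum_expList {n : ℕ} (ν : Fin n →₀ ℕ) : (expList ν).sum = ν.degree := by
  rw [expList, Finsupp.degree, ← List.sum_toFinset ν (Finset.sort_nodup _ _), Finset.sort_toFinset]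
  rfl

theorem expList_embDomain {k n : ℕ} (e : Fin k ↪o Fin n) (κ : Fin k →₀ ℕ) :
    expList (κ.embDomain e.toEmbedding) = expList κ := by
  rw [expList, expList, Finsupp.support_embDomain,
    ← Finset.map_sort (r := (· ≤ ·)) (r' := (· ≤ ·)) e.toEmbedding κ.support
      (fun a _ b _ => e.le_iff_le.symm), List.map_map]
  apply List.map_congr_left
  intro a _
  exact Finsupp.embDomain_apply_self _ _ _

theorem expList_smul {n m : ℕ} (hm : m ≠ 0) (κ : Fin n →₀ ℕ) :
    expList (m • κ) = (expList κ).map (m * ·) := by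
  rw [expList, expList, Finsupp.support_smul_eq hm, List.map_map]
  rfl

theorem expList_smul_inj {n m : ℕ} (hm : m ≠ 0) {κ κ' : Fin n →₀ ℕ} :
    expList (m • κ) = expList (m • κ') ↔ expList κ = expList κ' := by
  rw [expList_smul hm, expList_smul hm]
  exact (List.map_injective_iff.2 fun a b h => Nat.eq_of_mul_eq_mul_left (by omega) h).eq_iff

theorem card_filter_lt_orderEmbOfFin {n k : ℕ} (B : Finset (Fin n)) (h : B.card = k)
    (i : Fin k) : (B.filter (· < B.orderEmbOfFin h i)).card = i := by
  have : B.filter (· < B.orderEmbOfFin h i) =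
      (Finset.univ.filter (· < i)).map (B.orderEmbOfFin h).toEmbedding := by
    ext j
    simp only [Finset.mem_filter, Finset.mem_map, Finset.mem_univ, true_and]
    constructor
    · rintro ⟨hj, hlt⟩
      rw [← Finset.mem_coe, ← Finset.range_orderEmbOfFin B h] at hj
      obtain ⟨a, rfl⟩ := hj
      exact ⟨a, by simpa using hlt, rfl⟩
    · rintro ⟨a, ha, rfl⟩
      exact ⟨Finset.orderEmbOfFin_mem B h a, by simpa using ha⟩
  rw [this, Finset.card_map, Finset.filter_gt_eq_Iio, Fin.card_Iio]

theorem placeExp_orderEmbOfFin {n : ℕ} (B : Finset (Fin n)) (K : List ℕ)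
    (h : B.card = K.length) (i : Fin K.length) :
    placeExp B K (B.orderEmbOfFin h i) = K[i] := by
  simp only [placeExp, Finsupp.equivFunOnFinite_symm_apply_apply]
  rw [if_pos (Finset.orderEmbOfFin_mem B h i), card_filter_lt_orderEmbOfFin]
  simp

theorem support_placeExp {n : ℕ} (B : Finset (Fin n)) (K : List ℕ)
    (h : B.card = K.length) (hK : ∀ k ∈ K, k ≠ 0) : (placeExp B K).support = B := by
  ext j
  rw [Finsupp.mem_support_iff]
  constructor
  · intro hj
    by_contra hB
    exact hj (by simp [placeExp, hB])
  · intro hj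
    rw [← Finset.mem_coe, ← Finset.range_orderEmbOfFin B h] at hj
    obtain ⟨a, rfl⟩ := hj
    rw [placeExp_orderEmbOfFin]
    exact hK _ (List.getElem_mem _)

theorem expList_placeExp {n : ℕ} (B : Finset (Fin n)) (K : List ℕ)
    (h : B.card = K.length) (hK : ∀ k ∈ K, k ≠ 0) : expList (placeExp B K) = K := by
  apply List.ext_getElem
  · rw [length_expList, support_placeExp B K h hK, h]
  · intro i h1 h2
    simp only [expList, List.getElem_map, support_placeExp B K h hK]
    exact placeExp_orderEmbOfFin B K h ⟨i, h2⟩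

theorem placeExp_support_expList {n : ℕ} (ν : Fin n →₀ ℕ) :
    placeExp ν.support (expList ν) = ν := by
  ext j
  by_cases hj : j ∈ ν.support
  · have h := (length_expList ν).symm
    have hj' := hj
    rw [← Finset.mem_coe, ← Finset.range_orderEmbOfFin _ h] at hj'
    obtain ⟨a, rfl⟩ := hj'
    rw [placeExp_orderEmbOfFin]
    exact List.getElem_map (h := a.2) ν
  · rw [Finsupp.notMem_support_iff.1 hj]
    simp only [placeExp, Finsupp.equivFunOnFinite_symm_apply_apply, if_neg hj]

theorem expList_ne_zero {n : ℕ} (ν : Fin n →₀ ℕ) : ∀ k ∈ expList ν, k ≠ 0 := by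
  intro k hk
  obtain ⟨i, hi, rfl⟩ := mem_expList.1 hk
  exact hi

open MvPolynomial

/-! ### Quasi-symmetric polynomials and ballot exponents -/

/-- The quasi-symmetric polynomials without constant term. -/
def QSymPlus (n : ℕ) : Set (MvPolynomial (Fin n) ℂ) :=
  {P | (∀ ν ν', expList ν = expList ν' → coeff ν P = coeff ν' P) ∧ coeff 0 P = 0}

/-- The partial sums of `ν` satisfy `ν_0 + ⋯ + ν_l ≤ l + s` for all `l`. -/
def Ballot (s : ℕ) {n : ℕ} (ν : Fin n → ℕ) : Prop :=
  ∀ l : ℕ, ∑ j : Fin n, (if j.val ≤ l then ν j else 0) ≤ l + s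

/-- The span of the monomials whose exponents satisfy `Ballot s`. -/
def ballotSpan (n s : ℕ) : Submodule ℂ (MvPolynomial (Fin n) ℂ) :=
  Submodule.span ℂ {f | ∃ ν : Fin n →₀ ℕ, Ballot s ν ∧ f = monomial ν 1}

/-- A first entry `i` uses up `i` of the slack, and shifting the indices by one gives one unit back.
This is why the slack `s` has to vary in the induction on the number of variables. -/
theorem ballot_cons {n s i : ℕ} {ν : Fin n →₀ ℕ} (hi : i ≤ s) (h : Ballot (s + 1 - i) ν) :
    Ballot s (ν.cons i) := by
  intro l
  rw [Fin.sum_univ_succ]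
  simp only [Finsupp.cons_zero, Finsupp.cons_succ, Fin.val_zero, Nat.zero_le, if_true,
    Fin.val_succ]
  cases l with
  | zero => simp; omega
  | succ l =>
    have := h l
    simp only [Nat.add_le_add_iff_right]
    omega

theorem rename_succ_monomial {n : ℕ} (i : ℕ) (ν : Fin n →₀ ℕ) :
    (X 0 ^ i * rename Fin.succ (monomial ν (1 : ℂ)) : MvPolynomial (Fin (n + 1)) ℂ) =
      monomial (ν.cons i) 1 := by
  rw [rename_monomial, X_pow_eq_monomial, monomial_mul, one_mul]
  refine congrArg (fun u => monomial u (1 : ℂ)) (Finsupp.ext fun j => ?_)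
  refine Fin.cases ?_ (fun j => ?_) j
  · rw [Finsupp.add_apply, Finsupp.mapDomain_of_notMem_range]
    · simp
    · simp
  · rw [Finsupp.add_apply, Finsupp.mapDomain_apply (Fin.succ_injective n)]
    simp

theorem X_zero_pow_mul_rename_mem_ballotSpan {n s i : ℕ} (hi : i ≤ s)
    {f : MvPolynomial (Fin n) ℂ} (hf : f ∈ ballotSpan n (s + 1 - i)) :
    X 0 ^ i * rename Fin.succ f ∈ ballotSpan (n + 1) s := by
  induction hf using Submodule.span_induction with
  | mem f h =>
    obtain ⟨ν, hν, rfl⟩ := h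
    exact Submodule.subset_span ⟨_, ballot_cons hi hν, rename_succ_monomial i ν⟩
  | zero => simp
  | add f g _ _ hf hg =>
    rw [map_add, mul_add]
    exact add_mem hf hg
  | smul a f _ hf =>
    rw [map_smul, mul_smul_comm]
    exact Submodule.smul_mem _ a hf

/-! ### Fundamental quasi-symmetric polynomials -/

/-- The fundamental quasi-symmetric polynomial in `n` variables of the composition whose parts are
the entries of the list increased by one. -/
def fund : (n : ℕ) → List ℕ → MvPolynomial (Fin n) ℂ
  | _, [] => 1
  | 0, _ :: _ => 0
  | n + 1, e :: β =>
    ∑ j ∈ Finset.range (e + 1), X 0 ^ j * rename Fin.succ (fund n ((e - j) :: β)) +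
      X 0 ^ (e + 1) * rename Fin.succ (fund n β)

/-- The coefficients of the fundamental quasi-symmetric polynomials. -/
def fundCoeff : List ℕ → List ℕ → ℂ
  | [], [] => 1
  | [], _ :: _ => 0
  | a :: l, [] => if a = 0 then fundCoeff l [] else 0
  | a :: l, e :: β =>
    if a ≤ e then fundCoeff l ((e - a) :: β) else if a = e + 1 then fundCoeff l β else 0

/-- A zero exponent consumes nothing of the composition. This is what makes the fundamental
polynomials quasi-symmetric. -/
theorem fundCoeff_filter (l β : List ℕ) : fundCoeff (l.filter (· ≠ 0)) β = fundCoeff l β := by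
  induction l generalizing β with
  | nil => rfl
  | cons a l ih =>
    by_cases ha : a = 0
    · subst ha
      rw [List.filter_cons_of_neg (by simp), ih]
      cases β <;> simp [fundCoeff]
    · rw [List.filter_cons_of_pos (by simpa using ha)]
      cases β <;> simp only [fundCoeff, ih]

theorem coeff_cons_X_zero_pow_mul_rename {n : ℕ} (a i : ℕ) (ν : Fin n →₀ ℕ)
    (f : MvPolynomial (Fin n) ℂ) :
    coeff (ν.cons a) (X 0 ^ i * rename Fin.succ f : MvPolynomial (Fin (n + 1)) ℂ) =
      if a = i then coeff ν f else 0 := by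
  induction f using MvPolynomial.induction_on' with
  | monomial u c =>
    have : (monomial u c : MvPolynomial (Fin n) ℂ) = c • monomial u 1 := by
      rw [smul_monomial, smul_eq_mul, mul_one]
    rw [this, map_smul, mul_smul_comm, rename_succ_monomial, coeff_smul, coeff_smul,
      coeff_monomial, coeff_monomial]
    by_cases h : a = i
    · subst h
      simp [(Finsupp.cons_right_injective a).eq_iff]
    · have : Finsupp.cons i u ≠ Finsupp.cons a ν := fun h' =>
        h (Finsupp.cons_injective2 h').1.symm
      simp [h, this]
  | add p q hp hq =>
    rw [map_add, mul_add, coeff_add, hp, hq, coeff_add]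
    split_ifs <;> simp

theorem coeff_fund {n : ℕ} (ν : Fin n →₀ ℕ) (β : List ℕ) :
    coeff ν (fund n β) = fundCoeff (List.ofFn ν) β := by
  induction n generalizing β with
  | zero =>
    have : ν = 0 := Subsingleton.elim _ _
    subst this
    cases β <;> simp [fund, fundCoeff]
  | succ n ih =>
    obtain ⟨a, κ, rfl⟩ : ∃ a κ, ν = Finsupp.cons a κ := ⟨_, _, (Finsupp.cons_tail ν).symm⟩
    have hl : List.ofFn (Finsupp.cons a κ : Fin (n + 1) →₀ ℕ) = a :: List.ofFn κ := by
      rw [List.ofFn_succ]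
      simp
    rw [hl]
    cases β with
    | nil =>
      have h1 : (fund (n + 1) [] : MvPolynomial (Fin (n + 1)) ℂ) =
          X 0 ^ 0 * rename Fin.succ (fund n []) := by simp [fund]
      rw [h1, coeff_cons_X_zero_pow_mul_rename, ih]
      rfl
    | cons e β =>
      rw [fund, coeff_add, coeff_sum]
      simp only [coeff_cons_X_zero_pow_mul_rename, ih, Finset.sum_ite_eq, Finset.mem_range,
        fundCoeff]
      by_cases h : a ≤ e
      · have : a ≠ e + 1 := by omega
        simp [h, this, Nat.lt_succ_of_le h]
      · simp [h]

theorem fund_mem_QSymPlus (n : ℕ) {β : List ℕ} (hβ : β ≠ []) : fund n β ∈ QSymPlus n := by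
  refine ⟨fun ν ν' h => ?_, ?_⟩
  · rw [coeff_fund, coeff_fund, ← fundCoeff_filter, ← expList_eq_filter, h, expList_eq_filter,
      fundCoeff_filter]
  · rw [coeff_fund, ← fundCoeff_filter, ← expList_eq_filter, expList_zero]
    cases β
    · exact absurd rfl hβ
    · rfl

/-! ### Ballot monomials span modulo the ideal of quasi-symmetric polynomials -/

/-- The ideal generated by the fundamental quasi-symmetric polynomials of nonempty compositions
whose size exceeds their length by at least `s`. -/
def fundIdeal (n s : ℕ) : Ideal (MvPolynomial (Fin n) ℂ) :=
  Ideal.span {f | ∃ β : List ℕ, β ≠ [] ∧ s ≤ β.sum ∧ f = fund n β}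

theorem fund_mem_fundIdeal {n s : ℕ} {β : List ℕ} (h : β ≠ []) (hs : s ≤ β.sum) :
    fund n β ∈ fundIdeal n s := Ideal.subset_span ⟨β, h, hs, rfl⟩

theorem fund_zero_cons (n : ℕ) (β : List ℕ) :
    fund (n + 1) (0 :: β) = rename Fin.succ (fund n (0 :: β)) +
      X 0 * rename Fin.succ (fund n β) := by
  simp [fund]

theorem fund_succ_cons (n e : ℕ) (β : List ℕ) :
    fund (n + 1) ((e + 1) :: β) = rename Fin.succ (fund n ((e + 1) :: β)) +
      X 0 * fund (n + 1) (e :: β) := by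
  rw [fund, Finset.sum_range_succ', fund, mul_add, Finset.mul_sum, ← mul_assoc, ← pow_succ']
  simp only [Nat.add_sub_add_right, pow_succ', mul_assoc, pow_zero, one_mul, Nat.sub_zero]
  ring

/-- The shifted polynomial differs from the unshifted one by a multiple of `x_0`. If the head is
positive, the cofactor is a fundamental polynomial whose sum is one less, hence the margin `s + 1`;
if the head is zero, the cofactor is again shifted, with a shorter list of the same sum. -/
theorem rename_fund_mem_fundIdeal {n s : ℕ} {β : List ℕ} (hs : s + 1 ≤ β.sum) :
    rename Fin.succ (fund n β) ∈ fundIdeal (n + 1) s := by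
  induction β with
  | nil => simp at hs
  | cons e β ih =>
    rw [List.sum_cons] at hs
    cases e with
    | zero =>
      rw [eq_sub_of_add_eq (fund_zero_cons n β).symm]
      refine sub_mem (fund_mem_fundIdeal (by simp) (by simp; omega)) ?_
      exact Ideal.mul_mem_left _ _ (ih (by omega))
    | succ e =>
      rw [eq_sub_of_add_eq (fund_succ_cons n e β).symm]
      refine sub_mem (fund_mem_fundIdeal (by simp) (by simp; omega)) ?_
      exact Ideal.mul_mem_left _ _ (fund_mem_fundIdeal (by simp) (by simp; omega))

theorem X_zero_pow_mul_rename_fund (n e : ℕ) (β : List ℕ) :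
    (X 0 ^ (e + 1) * rename Fin.succ (fund n β) : MvPolynomial (Fin (n + 1)) ℂ) =
      fund (n + 1) (e :: β) -
        ∑ j ∈ Finset.range (e + 1), X 0 ^ j * rename Fin.succ (fund n ((e - j) :: β)) := by
  rw [fund]
  ring

theorem mem_of_X_zero_pow_mul_rename_mem {n : ℕ} {f : MvPolynomial (Fin (n + 1)) ℂ}
    {W : Submodule ℂ (MvPolynomial (Fin (n + 1)) ℂ)}
    (hW : ∀ i g, X 0 ^ i * rename Fin.succ g ∈ W) : f ∈ W := by
  induction f using MvPolynomial.induction_on' with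
  | monomial ν c =>
    obtain ⟨a, κ, rfl⟩ : ∃ a κ, ν = Finsupp.cons a κ := ⟨_, _, (Finsupp.cons_tail ν).symm⟩
    have : (monomial (κ.cons a) c : MvPolynomial (Fin (n + 1)) ℂ) =
        c • (X 0 ^ a * rename Fin.succ (monomial κ 1)) := by
      rw [rename_succ_monomial, smul_monomial, smul_eq_mul, mul_one]
    rw [this]
    exact W.smul_mem c (hW _ _)
  | add p q hp hq => exact add_mem hp hq

/-- Induction on `n`, then strong induction on the power `i` of the first variable. If `i ≤ s`, the
cofactor is reduced in the remaining variables with slack `s + 1 - i`, and its ideal part is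
rewritten into lower powers of `x_0`. If `i > s`, the power `x_0^i` itself is rewritten. -/
theorem fundIdeal_sup_ballotSpan (n s : ℕ) :
    (fundIdeal n s).restrictScalars ℂ ⊔ ballotSpan n s = ⊤ := by
  induction n generalizing s with
  | zero =>
    refine eq_top_iff.2 fun f _ => Submodule.mem_sup_right ?_
    have hf : f = coeff 0 f • monomial 0 1 := by
      rw [smul_monomial, smul_eq_mul, mul_one]
      exact MvPolynomial.eq_C_of_isEmpty f
    rw [hf]
    exact Submodule.smul_mem _ _ (Submodule.subset_span ⟨0, fun l => by simp, rfl⟩)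
  | succ n ih =>
    set W := (fundIdeal (n + 1) s).restrictScalars ℂ ⊔ ballotSpan (n + 1) s with hWdef
    have hI : ∀ f ∈ fundIdeal (n + 1) s, f ∈ W := fun f hf => Submodule.mem_sup_left hf
    rw [eq_top_iff]
    rintro f -
    refine mem_of_X_zero_pow_mul_rename_mem fun i => ?_
    clear f
    induction i using Nat.strong_induction_on with
    | _ i IH =>
    -- multiples of the power of the first variable by shifted fundamentals
    have key : ∀ β : List ℕ, β ≠ [] ∨ i ≠ 0 → s + 1 ≤ β.sum + i → ∀ g,
        X 0 ^ i * rename Fin.succ (g * fund n β) ∈ W := by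
      intro β hβ hs g
      rw [map_mul, mul_left_comm]
      cases i with
      | zero =>
        rw [pow_zero, one_mul]
        exact hI _ (Ideal.mul_mem_left _ _ (rename_fund_mem_fundIdeal (by omega)))
      | succ e =>
        -- The entry `e` stands for a part `e + 1`, so `e :: β` has sum at least `s` exactly when `s
        -- + 1 ≤ β.sum + (e + 1)`. The subtracted terms only involve powers `j ≤ e`.
        rw [X_zero_pow_mul_rename_fund, mul_sub, Finset.mul_sum]
        refine sub_mem (hI _ (Ideal.mul_mem_left _ _ (fund_mem_fundIdeal (by simp)
          (by simp; omega)))) (sum_mem fun j hj => ?_)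
        rw [mul_left_comm, ← map_mul]
        exact IH j (Finset.mem_range.1 hj) _
    intro g
    by_cases hi : i ≤ s
    · have hg : g ∈ (fundIdeal n (s + 1 - i)).restrictScalars ℂ ⊔ ballotSpan n (s + 1 - i) := by
        rw [ih]
        trivial
      obtain ⟨a, ha, b, hb, rfl⟩ := Submodule.mem_sup.1 hg
      -- `W` is only a `ℂ`-subspace, so the multiplier `c` is carried along to absorb the ring
      -- coefficients in the span induction.
      have hmul : ∀ c, X 0 ^ i * rename Fin.succ (c * a) ∈ W := by
        rw [Submodule.restrictScalars_mem] at ha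
        clear hg
        induction ha using Submodule.span_induction with
        | mem f h =>
          obtain ⟨β, hβ, hs, rfl⟩ := h
          exact key β (Or.inl hβ) (by omega)
        | zero => simp
        | add f g _ _ hf hg =>
          intro c
          rw [mul_add, map_add, mul_add]
          exact add_mem (hf c) (hg c)
        | smul d f _ hf =>
          intro c
          rw [smul_eq_mul, ← mul_assoc]
          exact hf _
      rw [map_add, mul_add]
      refine add_mem ?_ (Submodule.mem_sup_right (X_zero_pow_mul_rename_mem_ballotSpan hi hb))
      simpa using hmul 1
    -- Here `i > s`, and the empty composition has fundamental polynomial `1`.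
    · have := key [] (Or.inr (by omega)) (by simp; omega) g
      simpa [fund] using this

theorem span_QSymPlus_sup_ballotSpan (n : ℕ) :
    (Ideal.span (QSymPlus n)).restrictScalars ℂ ⊔ ballotSpan n 0 = ⊤ := by
  refine eq_top_iff.2 ((fundIdeal_sup_ballotSpan n 0).ge.trans (sup_le_sup_right ?_ _))
  intro f hf
  rw [Submodule.restrictScalars_mem] at hf ⊢
  refine Ideal.span_mono ?_ hf
  rintro _ ⟨β, hβ, _, rfl⟩
  exact fund_mem_QSymPlus n hβ

/-! ### Ballot monomials are independent modulo the ideal of quasi-symmetric polynomials -/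

/-- Set the variable `x_i` to zero and renumber the others. -/
def killVar {n : ℕ} (i : Fin (n + 1)) :
    MvPolynomial (Fin (n + 1)) ℂ →ₐ[ℂ] MvPolynomial (Fin n) ℂ :=
  aeval (i.insertNth 0 X : Fin (n + 1) → MvPolynomial (Fin n) ℂ)

/-- Remove the entry at `i` from an exponent vector. -/
def removeExp {n : ℕ} (i : Fin (n + 1)) (ν : Fin (n + 1) →₀ ℕ) : Fin n →₀ ℕ :=
  Finsupp.equivFunOnFinite.symm fun j => ν (i.succAbove j)

theorem removeExp_apply {n : ℕ} (i : Fin (n + 1)) (ν : Fin (n + 1) →₀ ℕ) (j : Fin n) :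
    removeExp i ν j = ν (i.succAbove j) := rfl

/-- Insert a zero entry at `i` into an exponent vector. -/
def insertExp {n : ℕ} (i : Fin (n + 1)) (κ : Fin n →₀ ℕ) : Fin (n + 1) →₀ ℕ :=
  κ.embDomain i.succAboveOrderEmb.toEmbedding

theorem insertExp_succAbove {n : ℕ} (i : Fin (n + 1)) (κ : Fin n →₀ ℕ) (j : Fin n) :
    insertExp i κ (i.succAbove j) = κ j :=
  Finsupp.embDomain_apply_self i.succAboveOrderEmb.toEmbedding κ j

theorem insertExp_self {n : ℕ} (i : Fin (n + 1)) (κ : Fin n →₀ ℕ) : insertExp i κ i = 0 := by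
  apply Finsupp.embDomain_of_notMem_range
  rintro ⟨j, hj⟩
  exact Fin.succAbove_ne i j hj

theorem insertExp_removeExp {n : ℕ} {i : Fin (n + 1)} {ν : Fin (n + 1) →₀ ℕ} (h : ν i = 0) :
    insertExp i (removeExp i ν) = ν := by
  ext j
  rcases Fin.eq_self_or_eq_succAbove i j with rfl | ⟨k, rfl⟩
  · rw [insertExp_self, h]
  · rw [insertExp_succAbove, removeExp_apply]

theorem removeExp_insertExp {n : ℕ} (i : Fin (n + 1)) (κ : Fin n →₀ ℕ) :
    removeExp i (insertExp i κ) = κ := by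
  ext j
  rw [removeExp_apply, insertExp_succAbove]

theorem killVar_monomial {n : ℕ} (i : Fin (n + 1)) (ν : Fin (n + 1) →₀ ℕ) (c : ℂ) :
    killVar i (monomial ν c) = if ν i = 0 then monomial (removeExp i ν) c else 0 := by
  rw [killVar, aeval_monomial, Finsupp.prod_fintype _ _ (fun _ => pow_zero _),
    Fin.prod_univ_succAbove _ i, Fin.insertNth_apply_same]
  simp only [Fin.insertNth_apply_succAbove]
  split_ifs with h
  · rw [h, pow_zero, one_mul, monomial_eq, Finsupp.prod_fintype _ _ (fun _ => pow_zero _)]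
    rfl
  · rw [zero_pow h, zero_mul, mul_zero]

theorem coeff_killVar {n : ℕ} (i : Fin (n + 1)) (κ : Fin n →₀ ℕ)
    (f : MvPolynomial (Fin (n + 1)) ℂ) :
    coeff κ (killVar i f) = coeff (insertExp i κ) f := by
  induction f using MvPolynomial.induction_on' with
  | monomial ν c =>
    rw [killVar_monomial, coeff_monomial]
    by_cases h : ν i = 0
    · rw [if_pos h, coeff_monomial]
      congr 1
      refine propext ⟨fun e => ?_, fun e => ?_⟩
      · rw [← e, insertExp_removeExp h]
      · rw [e, removeExp_insertExp]
    · rw [if_neg h, coeff_zero, if_neg]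
      rintro rfl
      exact h (insertExp_self i κ)
  | add p q hp hq => rw [map_add, coeff_add, coeff_add, hp, hq]

theorem killVar_mem_QSymPlus {n : ℕ} (i : Fin (n + 1)) {g : MvPolynomial (Fin (n + 1)) ℂ}
    (hg : g ∈ QSymPlus (n + 1)) : killVar i g ∈ QSymPlus n := by
  refine ⟨fun ν ν' h => ?_, ?_⟩
  · rw [coeff_killVar, coeff_killVar]
    refine hg.1 _ _ ?_
    rwa [insertExp, insertExp, expList_embDomain, expList_embDomain]
  · rw [coeff_killVar, insertExp, Finsupp.embDomain_zero, hg.2]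

theorem killVar_eq_killVar {n : ℕ} (i j : Fin (n + 1)) {g : MvPolynomial (Fin (n + 1)) ℂ}
    (hg : g ∈ QSymPlus (n + 1)) : killVar i g = killVar j g := by
  ext κ
  rw [coeff_killVar, coeff_killVar]
  refine hg.1 _ _ ?_
  rw [insertExp, insertExp, expList_embDomain, expList_embDomain]

/-- From position `i` on, deleting the zero entry shifts the indices by one, which weakens the bound
by one; subtracting one at `i` restores it. Before `i` nothing changes. -/
theorem ballot_removeExp_sub_single {n : ℕ} {p : Fin (n + 1)} {i : Fin n}
    (hp : p.val = i.val ∨ p.val = i.val + 1) {ν : Fin (n + 1) →₀ ℕ} (h : Ballot 0 ν)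
    (hpν : ν p = 0) (hi : removeExp p ν i ≠ 0) :
    Ballot 0 (removeExp p ν - Finsupp.single i 1 : Fin n →₀ ℕ) := by
  intro l
  have hsum : ∑ j : Fin n,
      (if j.val ≤ l then (removeExp p ν - Finsupp.single i 1 : Fin n →₀ ℕ) j else 0) +
      (if i.val ≤ l then 1 else 0) = ∑ j : Fin n, (if j.val ≤ l then removeExp p ν j else 0) := by
    have : (if i.val ≤ l then 1 else 0) =
        ∑ j : Fin n, (if j.val ≤ l then Finsupp.single i 1 j else 0) := by
      rw [Finset.sum_eq_single i]
      · simp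
      · intro j _ hj
        simp [hj.symm]
      · simp
    rw [this, ← Finset.sum_add_distrib]
    refine Finset.sum_congr rfl fun j _ => ?_
    split_ifs
    · rw [Finsupp.tsub_apply, Nat.sub_add_cancel]
      by_cases hj : i = j
      · subst hj
        simpa using Nat.one_le_iff_ne_zero.2 hi
      · simp [hj]
    · rfl
  have hL := h (if i.val ≤ l then l + 1 else l)
  rw [Fin.sum_univ_succAbove _ p, hpν, ite_self, zero_add] at hL
  have : ∑ j : Fin n, (if (p.succAbove j).val ≤ (if i.val ≤ l then l + 1 else l) then
      ν (p.succAbove j) else 0) = ∑ j : Fin n, (if j.val ≤ l then removeExp p ν j else 0) := by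
    refine Finset.sum_congr rfl fun j _ => ?_
    rw [removeExp_apply]
    congr 1
    refine propext ?_
    rw [Fin.succAbove]
    split_ifs with h1 h2 h2 <;> simp only [Fin.lt_def, Fin.val_castSucc, Fin.val_succ] at * <;>
      omega
  rw [this] at hL
  split_ifs at hL hsum <;> omega

theorem exists_killVar_sub_monomial {n : ℕ} (i : Fin n) (ν : Fin (n + 1) →₀ ℕ) (c : ℂ) :
    ∃ h, killVar i.succ (monomial ν c) - killVar i.castSucc (monomial ν c) = X i * h ∧
      (Ballot 0 ν → h ∈ ballotSpan n 0) := by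
  have key : ∀ p : Fin (n + 1), (p.val = i.val ∨ p.val = i.val + 1) → ν p = 0 →
      removeExp p ν i ≠ 0 → ∃ h, (monomial (removeExp p ν) c : MvPolynomial (Fin n) ℂ) = X i * h ∧
        (Ballot 0 ν → h ∈ ballotSpan n 0) := by
    intro p hp hpν hi
    refine ⟨c • monomial (removeExp p ν - Finsupp.single i 1) 1, ?_, fun hB =>
      Submodule.smul_mem _ _ (Submodule.subset_span
        ⟨_, ballot_removeExp_sub_single hp hB hpν hi, rfl⟩)⟩
    rw [smul_monomial, smul_eq_mul, mul_one, X, monomial_mul, one_mul, add_tsub_cancel_of_le]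
    exact Finsupp.single_le_iff.2 (Nat.one_le_iff_ne_zero.2 hi)
  have hs : removeExp i.succ ν i = ν i.castSucc := by
    rw [removeExp_apply, Fin.succAbove_succ_self]
  have hc : removeExp i.castSucc ν i = ν i.succ := by
    rw [removeExp_apply, Fin.succAbove_castSucc_self]
  rw [killVar_monomial, killVar_monomial]
  -- If both neighbouring entries vanish, deleting either gives the same vector; if neither does,
  -- both substitutions give zero. If exactly one vanishes, the other ends up at position `i`, so `X
  -- i` divides the surviving monomial.
  by_cases h1 : ν i.succ = 0 <;> by_cases h2 : ν i.castSucc = 0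
  · refine ⟨0, ?_, fun _ => zero_mem _⟩
    rw [if_pos h1, if_pos h2, mul_zero, sub_eq_zero]
    refine congrArg (fun u => monomial u c) (Finsupp.ext fun j => ?_)
    by_cases hj : j = i
    · subst hj
      rw [hs, hc, h1, h2]
    · rw [removeExp_apply, removeExp_apply]
      congr 1
      have : j.val ≠ i.val := fun h => hj (Fin.ext h)
      rw [Fin.succAbove, Fin.succAbove]
      split_ifs with h1 h2 h2 <;> simp only [Fin.lt_def, Fin.val_castSucc, Fin.val_succ] at * <;>
        omega
  · obtain ⟨h, e, hB⟩ := key i.succ (Or.inr rfl) h1 (by rwa [hs])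
    exact ⟨h, by rw [if_pos h1, if_neg h2, sub_zero, e], hB⟩
  · obtain ⟨h, e, hB⟩ := key i.castSucc (Or.inl rfl) h2 (by rwa [hc])
    exact ⟨-h, by rw [if_neg h1, if_pos h2, zero_sub, e, mul_neg], fun hb => neg_mem (hB hb)⟩
  · exact ⟨0, by rw [if_neg h1, if_neg h2, sub_zero, mul_zero], fun _ => zero_mem _⟩

theorem exists_killVar_sub {n : ℕ} (i : Fin n) (f : MvPolynomial (Fin (n + 1)) ℂ) :
    ∃ h, killVar i.succ f - killVar i.castSucc f = X i * h := by
  induction f using MvPolynomial.induction_on' with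
  | monomial ν c =>
    obtain ⟨h, e, _⟩ := exists_killVar_sub_monomial i ν c
    exact ⟨h, e⟩
  | add p q hp hq =>
    obtain ⟨a, ha⟩ := hp
    obtain ⟨b, hb⟩ := hq
    exact ⟨a + b, by rw [map_add, map_add, mul_add, ← ha, ← hb]; ring⟩

theorem exists_killVar_sub_of_mem_ballotSpan {n : ℕ} (i : Fin n)
    {f : MvPolynomial (Fin (n + 1)) ℂ} (hf : f ∈ ballotSpan (n + 1) 0) :
    ∃ h ∈ ballotSpan n 0, killVar i.succ f - killVar i.castSucc f = X i * h := by
  induction hf using Submodule.span_induction with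
  | mem f h =>
    obtain ⟨ν, hν, rfl⟩ := h
    obtain ⟨h, e, hB⟩ := exists_killVar_sub_monomial i ν 1
    exact ⟨h, hB hν, e⟩
  | zero => exact ⟨0, zero_mem _, by simp⟩
  | add p q _ _ hp hq =>
    obtain ⟨a, ha', ha⟩ := hp
    obtain ⟨b, hb', hb⟩ := hq
    exact ⟨a + b, add_mem ha' hb', by rw [map_add, map_add, mul_add, ← ha, ← hb]; ring⟩
  | smul c p _ hp =>
    obtain ⟨a, ha', ha⟩ := hp
    exact ⟨c • a, Submodule.smul_mem _ _ ha', by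
      rw [map_smul, map_smul, ← smul_sub, ha, mul_smul_comm]⟩

/-- On quasi-symmetric generators the difference vanishes; multiples are handled by a twisted
Leibniz rule. The rule also involves `killVar i.castSucc p` itself, which is why its membership in
the ideal is proved simultaneously. -/
theorem exists_killVar_sub_of_mem_span_QSymPlus {n : ℕ} (i : Fin n)
    {f : MvPolynomial (Fin (n + 1)) ℂ} (hf : f ∈ Ideal.span (QSymPlus (n + 1))) :
    killVar i.castSucc f ∈ Ideal.span (QSymPlus n) ∧
      ∃ h ∈ Ideal.span (QSymPlus n), killVar i.succ f - killVar i.castSucc f = X i * h := by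
  induction hf using Submodule.span_induction with
  | mem f h =>
    refine ⟨Ideal.subset_span (killVar_mem_QSymPlus _ h), 0, zero_mem _, ?_⟩
    rw [killVar_eq_killVar i.succ i.castSucc h, sub_self, mul_zero]
  | zero => exact ⟨by simp, 0, zero_mem _, by simp⟩
  | add p q _ _ hp hq =>
    obtain ⟨hp, a, ha', ha⟩ := hp
    obtain ⟨hq, b, hb', hb⟩ := hq
    exact ⟨by rw [map_add]; exact add_mem hp hq, a + b, add_mem ha' hb',
      by rw [map_add, map_add, mul_add, ← ha, ← hb]; ring⟩
  | smul c p _ hp =>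
    obtain ⟨hp, a, ha', ha⟩ := hp
    obtain ⟨d, hd⟩ := exists_killVar_sub i c
    refine ⟨by rw [smul_eq_mul, map_mul]; exact Ideal.mul_mem_left _ _ hp,
      killVar i.succ c * a + d * killVar i.castSucc p,
      add_mem (Ideal.mul_mem_left _ _ ha') (Ideal.mul_mem_left _ _ hp), ?_⟩
    rw [smul_eq_mul, map_mul, map_mul]
    linear_combination (killVar i.succ c) * ha + (killVar i.castSucc p) * hd

theorem ballot_of_coeff_ne_zero {n s : ℕ} {f : MvPolynomial (Fin n) ℂ} (hf : f ∈ ballotSpan n s)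
    {ν : Fin n →₀ ℕ} (hν : coeff ν f ≠ 0) : Ballot s ν := by
  by_contra hB
  apply hν
  clear hν
  induction hf using Submodule.span_induction with
  | mem f h =>
    obtain ⟨κ, hκ, rfl⟩ := h
    rw [coeff_monomial, if_neg]
    rintro rfl
    exact hB hκ
  | zero => simp
  | add p q _ _ hp hq => rw [coeff_add, hp, hq, add_zero]
  | smul c p _ hp => rw [coeff_smul, hp, smul_zero]

theorem coeff_zero_of_mem_span_QSymPlus {n : ℕ} {f : MvPolynomial (Fin n) ℂ}
    (hf : f ∈ Ideal.span (QSymPlus n)) : coeff 0 f = 0 := by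
  have : Ideal.span (QSymPlus n) ≤ RingHom.ker (constantCoeff (R := ℂ) (σ := Fin n)) :=
    Ideal.span_le.2 fun g hg => hg.2
  exact this hf

/-- The quotients by `X i` lie in the same intersection in one variable fewer, hence vanish, so
setting any one variable to zero gives the same result. Together with the ballot condition this
forces `f` to be constant, and the ideal contains no nonzero constant. -/
theorem eq_zero_of_mem_span_QSymPlus_of_mem_ballotSpan {n : ℕ} {f : MvPolynomial (Fin n) ℂ}
    (hI : f ∈ Ideal.span (QSymPlus n)) (hB : f ∈ ballotSpan n 0) : f = 0 := by
  induction n with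
  | zero =>
    rw [MvPolynomial.eq_C_of_isEmpty f, coeff_zero_of_mem_span_QSymPlus hI, C_0]
  | succ n ih =>
    have hstep : ∀ i : Fin n, killVar i.succ f = killVar i.castSucc f := by
      intro i
      obtain ⟨h, hh, e⟩ := exists_killVar_sub_of_mem_ballotSpan i hB
      obtain ⟨-, h', hh', e'⟩ := exists_killVar_sub_of_mem_span_QSymPlus i hI
      have : h = h' := mul_left_cancel₀ (X_ne_zero i) (e.symm.trans e')
      subst this
      rw [ih hh' hh, mul_zero] at e
      exact sub_eq_zero.1 e
    have hall : ∀ i : Fin (n + 1), killVar i f = killVar 0 f := by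
      intro i
      induction i using Fin.induction with
      | zero => rfl
      | succ i hi => rw [hstep, hi]
    -- The ballot condition at `l = 0` makes the first exponent zero. Moving this zero to the end
    -- keeps the coefficient, because `killVar 0` and `killVar (Fin.last n)` agree on `f`; the next
    -- exponent then comes first and vanishes in turn.
    have hvan : ∀ j : ℕ, ∀ ν, coeff ν f ≠ 0 → ∀ i : Fin (n + 1), i.val ≤ j → ν i = 0 := by
      have h0 : ∀ ν, coeff ν f ≠ 0 → ν 0 = 0 := by
        intro ν hν
        have := ballot_of_coeff_ne_zero hB hν 0
        rw [Fin.sum_univ_succ] at this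
        simp at this
        exact this
      intro j
      induction j with
      | zero =>
        intro ν hν i hi
        have : i = 0 := Fin.ext (by simpa using hi)
        exact this ▸ h0 ν hν
      | succ j IH =>
        intro ν hν i hi
        have hν0 := h0 ν hν
        refine Fin.cases (fun _ => hν0) (fun k hk => ?_) i hi
        rw [← insertExp_removeExp hν0, ← coeff_killVar, ← hall (Fin.last n), coeff_killVar] at hν
        have := IH _ hν k.castSucc (by simpa using hk)
        rw [← Fin.succAbove_last_apply, insertExp_succAbove, removeExp_apply] at this
        simpa using this
    ext ν
    rw [coeff_zero]
    by_contra hν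
    have : ν = 0 := by
      ext i
      exact hvan n ν hν i (by omega)
    exact hν (this ▸ coeff_zero_of_mem_span_QSymPlus hI)

/-! ### The quasi-invariant polynomials -/

/-- Move the nonzero entries of `ν`, in order, to the positions given by the image of the support
under the permutation `π`. -/
def permExp {n : ℕ} (π : Equiv.Perm (Fin n)) (ν : Fin n →₀ ℕ) : Fin n →₀ ℕ :=
  placeExp (ν.support.map π.toEmbedding) (expList ν)

theorem expList_permExp {n : ℕ} (π : Equiv.Perm (Fin n)) (ν : Fin n →₀ ℕ) :
    expList (permExp π ν) = expList ν :=
  expList_placeExp _ _ (by rw [Finset.card_map, length_expList]) (expList_ne_zero ν)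

theorem support_permExp {n : ℕ} (π : Equiv.Perm (Fin n)) (ν : Fin n →₀ ℕ) :
    (permExp π ν).support = ν.support.map π.toEmbedding :=
  support_placeExp _ _ (by rw [Finset.card_map, length_expList]) (expList_ne_zero ν)

theorem permExp_symm_permExp {n : ℕ} (π : Equiv.Perm (Fin n)) (ν : Fin n →₀ ℕ) :
    permExp π.symm (permExp π ν) = ν := by
  rw [permExp, expList_permExp, support_permExp, Finset.map_map]
  convert placeExp_support_expList ν
  ext j
  simp

/-- The matrix with the entries `d i` at the positions `(i, π i)`. -/
def monomialMatrix {n : ℕ} (π : Equiv.Perm (Fin n)) (d : Fin n → ℂ) :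
    Matrix (Fin n) (Fin n) ℂ := fun i j => if j = π i then d i else 0

theorem monomialMatrix_ne_zero_iff {n : ℕ} (π : Equiv.Perm (Fin n)) {d : Fin n → ℂ}
    (hd : ∀ i, d i ≠ 0) (i j : Fin n) : monomialMatrix π d i j ≠ 0 ↔ j = π i := by
  rw [monomialMatrix]
  split_ifs with h <;> simp [h, hd]

theorem mem_genSymGroup_iff {n m : ℕ} (hm : m ≠ 0) {g : Matrix (Fin n) (Fin n) ℂ} :
    g ∈ genSymGroup n m ↔
      ∃ (π : Equiv.Perm (Fin n)) (d : Fin n → ℂ), (∀ i, d i ^ m = 1) ∧ g = monomialMatrix π d := by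
  constructor
  · rintro ⟨hrow, hcol, hroot⟩
    choose f hf hf' using hrow
    have hbij : Function.Bijective f := by
      refine Finite.injective_iff_bijective.1 fun a b hab => ?_
      exact (hcol (f a)).unique (hf a) (hab ▸ hf b)
    refine ⟨Equiv.ofBijective f hbij, fun i => g i (f i), fun i => hroot _ _ (hf i), ?_⟩
    ext i j
    rw [monomialMatrix, Equiv.ofBijective_apply]
    split_ifs with h
    · rw [h]
    · by_contra h0
      exact h (hf' i j h0)
  · rintro ⟨π, d, hd, rfl⟩
    have hd0 : ∀ i, d i ≠ 0 := by
      intro i h0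
      have := hd i
      rw [h0, zero_pow hm] at this
      exact zero_ne_one this
    simp only [genSymGroup, Set.mem_ofPred_eq, monomialMatrix_ne_zero_iff π hd0]
    refine ⟨fun i => ⟨π i, rfl, fun _ h => h⟩, fun j => ⟨π.symm j, by simp, ?_⟩, ?_⟩
    · rintro i rfl
      simp
    · rintro i _ rfl
      rw [monomialMatrix, if_pos rfl, hd]

theorem weight_monomialMatrix {n : ℕ} (π : Equiv.Perm (Fin n)) {d : Fin n → ℂ}
    (hd : ∀ i, d i ≠ 0) : weight (monomialMatrix π d) = ∏ i, d i := by
  refine Finset.prod_congr rfl fun i _ => ?_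
  rw [Finset.prod_eq_single (π i)]
  · simp [monomialMatrix, hd]
  · intro j _ hj
    simp [monomialMatrix, hj]
  · simp

theorem coeff_quasiAct {n m : ℕ} (π : Equiv.Perm (Fin n)) {d : Fin n → ℂ}
    (hd : ∀ i, d i ≠ 0) (P : MvPolynomial (Fin n) ℂ) (κ : Fin n →₀ ℕ) :
    coeff κ (quasiAct m (monomialMatrix π d) P) =
      (∏ i, d i) ^ cExp m (expList κ) * coeff (permExp π.symm κ) P := by
  have himage (A : Finset (Fin n)) : imageVars (monomialMatrix π d) A = A.map π.toEmbedding := by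
    ext j
    simp [imageVars, monomialMatrix_ne_zero_iff π hd, ← Equiv.symm_apply_eq]
  induction P using MvPolynomial.induction_on' with
  | monomial ν c =>
    have h1 : quasiAct m (monomialMatrix π d) (monomial ν 1) =
        monomial (permExp π ν) ((∏ i, d i) ^ cExp m (expList ν)) := by
      have : (monomial ν 1 : MvPolynomial (Fin n) ℂ) = basisMonomials (Fin n) ℂ ν := by
        rw [coe_basisMonomials]
      rw [quasiAct, this, Module.Basis.constr_basis, himage, weight_monomialMatrix π hd]
      rfl
    have h2 : (monomial ν c : MvPolynomial (Fin n) ℂ) = c • monomial ν 1 := by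
      rw [smul_monomial, smul_eq_mul, mul_one]
    rw [h2, map_smul, h1, coeff_smul, coeff_smul, coeff_monomial, coeff_monomial]
    by_cases h : permExp π ν = κ
    · subst h
      rw [permExp_symm_permExp, expList_permExp]
      simp [mul_comm]
    · rw [if_neg h, if_neg]
      · simp
      · rintro rfl
        exact h (permExp_symm_permExp π.symm κ)
  | add p q hp hq => rw [map_add, coeff_add, hp, hq, coeff_add, mul_add]

theorem forall_mem_expList_dvd_iff {n m : ℕ} (ν : Fin n →₀ ℕ) :
    (∀ k ∈ expList ν, m ∣ k) ↔ ∀ i, m ∣ ν i := by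
  refine ⟨fun h i => ?_, fun h k hk => ?_⟩
  · by_cases hi : ν i = 0
    · simp [hi]
    · exact h _ (mem_expList.2 ⟨i, hi, rfl⟩)
  · obtain ⟨i, -, rfl⟩ := mem_expList.1 hk
    exact h i

open Classical in
theorem cExp_expList {n m : ℕ} (ν : Fin n →₀ ℕ) :
    cExp m (expList ν) = if ∀ i, m ∣ ν i then 0 else 1 := by
  rw [cExp]
  congr 1
  exact propext (forall_mem_expList_dvd_iff ν)

/-- The entrywise quotient of an exponent vector by `m`. -/
def divExp {n : ℕ} (m : ℕ) (ν : Fin n →₀ ℕ) : Fin n →₀ ℕ := ν.mapRange (· / m) (Nat.zero_div m)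

theorem smul_divExp {n m : ℕ} {ν : Fin n →₀ ℕ} (h : ∀ i, m ∣ ν i) : m • divExp m ν = ν := by
  ext i
  simp [divExp, Nat.mul_div_cancel' (h i)]

/-- Permutation matrices give the condition on coefficients, diagonal matrices the divisibility.
Conversely, when all exponents are divisible by `m` the weight enters with exponent `0`. -/
theorem mem_QInv_iff {n m : ℕ} (hm : m ≠ 0) {P : MvPolynomial (Fin n) ℂ} :
    P ∈ QInv n m ↔ (∀ ν ν', expList ν = expList ν' → coeff ν P = coeff ν' P) ∧
      ∀ ν, coeff ν P ≠ 0 → ∀ i, m ∣ ν i := by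
  constructor
  · intro hP
    have hcoeff : ∀ (π : Equiv.Perm (Fin n)) (d : Fin n → ℂ), (∀ i, d i ^ m = 1) → ∀ κ,
        coeff κ P = (∏ i, d i) ^ cExp m (expList κ) * coeff (permExp π.symm κ) P := by
      intro π d hd κ
      rw [← coeff_quasiAct π, hP _ ((mem_genSymGroup_iff hm).2 ⟨π, d, hd, rfl⟩)]
      intro i h0
      have := hd i
      rw [h0, zero_pow hm] at this
      exact zero_ne_one this
    refine ⟨fun ν ν' h => ?_, fun ν hν i => ?_⟩
    · have hcard : ν'.support.card = ν.support.card := by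
        rw [← length_expList, ← length_expList, h]
      -- Any bijection of the supports will do, since the action reorders the variables; it is
      -- extended to a permutation of all indices.
      let e : {x // x ∈ ν'.support} ≃ {x // x ∈ ν.support} := Finset.equivOfCardEq hcard
      have hmap : ν.support.map e.extendSubtype.symm.toEmbedding = ν'.support := by
        symm
        apply Finset.eq_of_subset_of_card_le
        · intro x hx
          rw [Finset.mem_map_equiv]
          exact e.extendSubtype_mem x hx
        · rw [Finset.card_map, hcard]
      have := hcoeff e.extendSubtype (fun _ => 1) (by simp) ν
      rw [permExp, hmap, h, placeExp_support_expList] at this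
      simpa using this
    · by_contra hi
      have hroot := Complex.isPrimitiveRoot_exp m hm
      set ζ := Complex.exp (2 * Real.pi * Complex.I / m)
      have := hcoeff 1 (Function.update 1 i ζ) (fun j => by
        by_cases hj : j = i
        · subst hj
          simpa using hroot.pow_eq_one
        · simp [hj]) ν
      rw [Finset.prod_update_of_mem (Finset.mem_univ i), cExp_expList,
        if_neg fun h => hi (h i)] at this
      have hone : permExp (Equiv.symm 1) ν = ν := by
        rw [permExp]
        convert placeExp_support_expList ν
        ext j
        simp
      rw [hone] at this
      -- The diagonal matrix has weight `ζ`, so a nonzero coefficient with `c(K) = 1` forces `ζ =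
      -- 1`. Then `m = 1`, which divides every exponent.
      have hζ : ζ = 1 := by simpa [hν] using this
      rw [hζ] at hroot
      have hm1 : m = 1 := hroot.unique IsPrimitiveRoot.one
      exact hi (hm1 ▸ one_dvd _)
  · rintro ⟨h1, h2⟩ g hg
    obtain ⟨π, d, hd, rfl⟩ := (mem_genSymGroup_iff hm).1 hg
    ext κ
    rw [coeff_quasiAct, h1 _ κ (expList_permExp _ _), cExp_expList]
    · split_ifs with h
      · simp
      · rw [not_imp_comm.1 (h2 κ) h, mul_zero]
    · intro i h0
      have := hd i
      rw [h0, zero_pow hm] at this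
      exact zero_ne_one this

theorem mem_QInvPlus_iff {n m : ℕ} (hm : m ≠ 0) {P : MvPolynomial (Fin n) ℂ} :
    P ∈ QInvPlus n m ↔ ∃ g ∈ QSymPlus n, P = expand m g := by
  constructor
  · rintro ⟨hP, h0⟩
    obtain ⟨h1, h2⟩ := (mem_QInv_iff hm).1 hP
    let g : MvPolynomial (Fin n) ℂ := ∑ ν ∈ P.support, monomial (divExp m ν) (coeff ν P)
    have hg : expand m g = P := by
      conv_rhs => rw [P.as_sum]
      rw [map_sum]
      refine Finset.sum_congr rfl fun ν hν => ?_
      rw [expand_monomial, smul_divExp (h2 ν (mem_support_iff.1 hν))]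
    refine ⟨g, ⟨fun κ κ' h => ?_, ?_⟩, hg.symm⟩
    · rw [← coeff_expand_smul m hm g κ, ← coeff_expand_smul m hm g κ', hg]
      exact h1 _ _ ((expList_smul_inj hm).2 h)
    · rw [← coeff_expand_zero m hm, hg]
      exact h0
  · rintro ⟨g, ⟨h1, h0⟩, rfl⟩
    have hdvd : ∀ ν, coeff ν (expand m g) ≠ 0 → ∀ i, m ∣ ν i := by
      intro ν hν i
      by_contra h
      exact hν (coeff_expand_of_not_dvd g h)
    refine ⟨(mem_QInv_iff hm).2 ⟨fun ν ν' h => ?_, hdvd⟩, ?_⟩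
    · have hiff : (∀ i, m ∣ ν i) ↔ ∀ i, m ∣ ν' i := by
        rw [← forall_mem_expList_dvd_iff, ← forall_mem_expList_dvd_iff, h]
      by_cases hν : ∀ i, m ∣ ν i
      · rw [← smul_divExp hν, ← smul_divExp (hiff.1 hν)] at h ⊢
        rw [coeff_expand_smul m hm, coeff_expand_smul m hm]
        exact h1 _ _ ((expList_smul_inj hm).1 h)
      · rw [not_imp_comm.1 (hdvd ν) hν, not_imp_comm.1 (hdvd ν') (fun h' => hν (hiff.2 h'))]
    · rw [constantCoeff_eq, coeff_expand_zero m hm, h0]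

/-! ### Ballot monomials modulo the ideal of quasi-invariant polynomials -/

/-- The entrywise remainder of an exponent vector modulo `m`. -/
def modExp {n : ℕ} (m : ℕ) (ν : Fin n →₀ ℕ) : Fin n →₀ ℕ := ν.mapRange (· % m) (Nat.zero_mod m)

theorem modExp_add_smul_divExp {n : ℕ} (m : ℕ) (ν : Fin n →₀ ℕ) :
    modExp m ν + m • divExp m ν = ν := by
  ext i
  simp [modExp, divExp, Nat.mod_add_div]

theorem divExp_add_smul {n m : ℕ} {r : Fin n →₀ ℕ} (hr : ∀ i, r i < m) (κ : Fin n →₀ ℕ) :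
    divExp m (r + m • κ) = κ := by
  ext i
  have : 0 < m := (Nat.zero_le _).trans_lt (hr i)
  simp [divExp, Nat.add_mul_div_left _ _ this, Nat.div_eq_of_lt (hr i)]

theorem modExp_add_smul {n m : ℕ} {r : Fin n →₀ ℕ} (hr : ∀ i, r i < m) (κ : Fin n →₀ ℕ) :
    modExp m (r + m • κ) = r := by
  ext i
  simp [modExp, Nat.mod_eq_of_lt (hr i)]

theorem modExp_lt {n m : ℕ} (hm : m ≠ 0) (ν : Fin n →₀ ℕ) (i : Fin n) : modExp m ν i < m :=
  Nat.mod_lt _ (Nat.pos_of_ne_zero hm)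

/-- The span of the monomials whose exponents, divided by `m`, are ballot vectors. -/
def ballotSpanDiv (n m : ℕ) : Submodule ℂ (MvPolynomial (Fin n) ℂ) :=
  Submodule.span ℂ {f | ∃ ν : Fin n →₀ ℕ, Ballot 0 (divExp m ν) ∧ f = monomial ν 1}

theorem expand_mem_span_QInvPlus {n m : ℕ} (hm : m ≠ 0) {f : MvPolynomial (Fin n) ℂ}
    (hf : f ∈ Ideal.span (QSymPlus n)) : expand m f ∈ Ideal.span (QInvPlus n m) := by
  have : Ideal.span (QSymPlus n) ≤ (Ideal.span (QInvPlus n m)).comap (expand m).toRingHom :=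
    Ideal.span_le.2 fun g hg => Ideal.subset_span ((mem_QInvPlus_iff hm).2 ⟨g, hg, rfl⟩)
  exact this hf

theorem monomial_mul_expand_mem_ballotSpanDiv {n m : ℕ} {r : Fin n →₀ ℕ} (hr : ∀ i, r i < m)
    {f : MvPolynomial (Fin n) ℂ} (hf : f ∈ ballotSpan n 0) :
    monomial r 1 * expand m f ∈ ballotSpanDiv n m := by
  induction hf using Submodule.span_induction with
  | mem f h =>
    obtain ⟨ν, hν, rfl⟩ := h
    refine Submodule.subset_span ⟨r + m • ν, by rwa [divExp_add_smul hr], ?_⟩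
    rw [expand_monomial, monomial_mul, one_mul]
  | zero => simp
  | add f g _ _ hf hg =>
    rw [map_add, mul_add]
    exact add_mem hf hg
  | smul a f _ hf =>
    rw [map_smul, mul_smul_comm]
    exact Submodule.smul_mem _ a hf

theorem span_QInvPlus_sup_ballotSpanDiv (n : ℕ) {m : ℕ} (hm : m ≠ 0) :
    (Ideal.span (QInvPlus n m)).restrictScalars ℂ ⊔ ballotSpanDiv n m = ⊤ := by
  rw [eq_top_iff]
  rintro f -
  induction f using MvPolynomial.induction_on' with
  | monomial ν c =>
    have hν : (monomial ν c : MvPolynomial (Fin n) ℂ) =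
        c • (monomial (modExp m ν) 1 * expand m (monomial (divExp m ν) 1)) := by
      rw [expand_monomial, monomial_mul, modExp_add_smul_divExp, smul_monomial]
      simp
    rw [hν]
    refine Submodule.smul_mem _ _ ?_
    have hκ : (monomial (divExp m ν) 1 : MvPolynomial (Fin n) ℂ) ∈
        (Ideal.span (QSymPlus n)).restrictScalars ℂ ⊔ ballotSpan n 0 := by
      rw [span_QSymPlus_sup_ballotSpan]
      trivial
    obtain ⟨a, ha, b, hb, hab⟩ := Submodule.mem_sup.1 hκ
    rw [← hab, map_add, mul_add]
    exact add_mem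
      (Submodule.mem_sup_left (Ideal.mul_mem_left _ _ (expand_mem_span_QInvPlus hm ha)))
      (Submodule.mem_sup_right (monomial_mul_expand_mem_ballotSpanDiv (modExp_lt hm ν) hb))
  | add p q hp hq => exact add_mem hp hq

/-- The component `f_r` of a polynomial written as `∑_r X^r f_r(X^m)`. -/
def residuePart {n : ℕ} (m : ℕ) (r : Fin n →₀ ℕ) :
    MvPolynomial (Fin n) ℂ →ₗ[ℂ] MvPolynomial (Fin n) ℂ :=
  (basisMonomials (Fin n) ℂ).constr ℂ fun ν =>
    if modExp m ν = r then monomial (divExp m ν) 1 else 0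

theorem residuePart_monomial {n m : ℕ} (r ν : Fin n →₀ ℕ) (c : ℂ) :
    residuePart m r (monomial ν c) = if modExp m ν = r then monomial (divExp m ν) c else 0 := by
  have h1 : residuePart m r (monomial ν 1) =
      if modExp m ν = r then monomial (divExp m ν) 1 else 0 := by
    have : (monomial ν 1 : MvPolynomial (Fin n) ℂ) = basisMonomials (Fin n) ℂ ν := by
      rw [coe_basisMonomials]
    rw [residuePart, this, Module.Basis.constr_basis]
  have h2 : (monomial ν c : MvPolynomial (Fin n) ℂ) = c • monomial ν 1 := by
    rw [smul_monomial, smul_eq_mul, mul_one]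
  rw [h2, map_smul, h1, smul_ite, smul_monomial, smul_zero, smul_eq_mul, mul_one]

theorem coeff_residuePart {n m : ℕ} {r : Fin n →₀ ℕ} (hr : ∀ i, r i < m) (κ : Fin n →₀ ℕ)
    (f : MvPolynomial (Fin n) ℂ) : coeff κ (residuePart m r f) = coeff (r + m • κ) f := by
  induction f using MvPolynomial.induction_on' with
  | monomial ν c =>
    rw [residuePart_monomial, coeff_monomial]
    by_cases h : ν = r + m • κ
    · subst h
      rw [modExp_add_smul hr, divExp_add_smul hr]
      simp
    · rw [if_neg h]
      split_ifs with h1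
      · rw [coeff_monomial, if_neg]
        rintro rfl
        exact h (h1 ▸ (modExp_add_smul_divExp m ν).symm)
      · rfl
  | add p q hp hq => rw [map_add, coeff_add, coeff_add, hp, hq]

/-- Multiplying by a polynomial in `X^m` leaves remainders unchanged and acts on the quotients. This
linearity carries the quasi-invariant ideal into the quasi-symmetric one. -/
theorem residuePart_mul_expand {n m : ℕ} {r : Fin n →₀ ℕ} (hr : ∀ i, r i < m)
    (f g : MvPolynomial (Fin n) ℂ) :
    residuePart m r (f * expand m g) = residuePart m r f * g := by
  induction g using MvPolynomial.induction_on' with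
  | monomial κ d =>
    induction f using MvPolynomial.induction_on' with
    | monomial ν c =>
      have hm : ν + m • κ = modExp m ν + m • (divExp m ν + κ) := by
        rw [smul_add, ← add_assoc, modExp_add_smul_divExp]
      rw [expand_monomial, monomial_mul, residuePart_monomial, residuePart_monomial, hm]
      -- The bound on `r` gives `m ≠ 0` only in the presence of an index; for `n = 0` it is not
      -- needed.
      have hm0 : ∀ i, m ≠ 0 := fun i : Fin n => ((Nat.zero_le _).trans_lt (hr i)).ne'
      have hlt : ∀ i, modExp m ν i < m := fun i => modExp_lt (hm0 i) ν i
      rw [modExp_add_smul hlt, divExp_add_smul hlt]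
      split_ifs
      · rw [monomial_mul]
      · rw [zero_mul]
    | add p q hp hq => rw [add_mul, map_add, hp, hq, map_add, add_mul]
  | add p q hp hq => rw [map_add, mul_add, map_add, hp, hq, mul_add]

theorem residuePart_mem_span_QSymPlus {n m : ℕ} (hm : m ≠ 0) {r : Fin n →₀ ℕ}
    (hr : ∀ i, r i < m) {f : MvPolynomial (Fin n) ℂ} (hf : f ∈ Ideal.span (QInvPlus n m)) :
    residuePart m r f ∈ Ideal.span (QSymPlus n) := by
  have : ∀ c, residuePart m r (c * f) ∈ Ideal.span (QSymPlus n) := by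
    induction hf using Submodule.span_induction with
    | mem f h =>
      intro c
      obtain ⟨g, hg, rfl⟩ := (mem_QInvPlus_iff hm).1 h
      rw [residuePart_mul_expand hr]
      exact Ideal.mul_mem_left _ _ (Ideal.subset_span hg)
    | zero => simp
    | add f g _ _ hf hg =>
      intro c
      rw [mul_add, map_add]
      exact add_mem (hf c) (hg c)
    | smul a f _ hf =>
      intro c
      rw [smul_eq_mul, ← mul_assoc]
      exact hf _
  simpa using this 1

theorem residuePart_mem_ballotSpan {n m : ℕ} (r : Fin n →₀ ℕ) {f : MvPolynomial (Fin n) ℂ}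
    (hf : f ∈ ballotSpanDiv n m) : residuePart m r f ∈ ballotSpan n 0 := by
  induction hf using Submodule.span_induction with
  | mem f h =>
    obtain ⟨ν, hν, rfl⟩ := h
    rw [residuePart_monomial]
    split_ifs
    · exact Submodule.subset_span ⟨_, hν, rfl⟩
    · exact zero_mem _
  | zero => simp
  | add f g _ _ hf hg =>
    rw [map_add]
    exact add_mem hf hg
  | smul a f _ hf =>
    rw [map_smul]
    exact Submodule.smul_mem _ a hf

theorem isCompl_span_QInvPlus_ballotSpanDiv (n : ℕ) {m : ℕ} (hm : m ≠ 0) :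
    IsCompl (ballotSpanDiv n m) ((Ideal.span (QInvPlus n m)).restrictScalars ℂ) := by
  refine IsCompl.symm ⟨Submodule.disjoint_def.2 fun f hI hB => ?_,
    codisjoint_iff.2 (span_QInvPlus_sup_ballotSpanDiv n hm)⟩
  ext ν
  rw [← modExp_add_smul_divExp m ν, ← coeff_residuePart (modExp_lt hm ν),
    eq_zero_of_mem_span_QSymPlus_of_mem_ballotSpan
      (residuePart_mem_span_QSymPlus hm (modExp_lt hm ν) hI) (residuePart_mem_ballotSpan _ hB),
    coeff_zero, coeff_zero]

/-! ### The dimension of the space of super-coinvariants of given degree -/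

/-- The product of the factorials of the entries of an exponent vector. -/
def expFactorial {n : ℕ} (ν : Fin n →₀ ℕ) : ℂ := ∏ i, ((ν i).factorial : ℂ)

theorem expFactorial_ne_zero {n : ℕ} (ν : Fin n →₀ ℕ) : expFactorial ν ≠ 0 :=
  Finset.prod_ne_zero_iff.2 fun _ _ => Nat.cast_ne_zero.2 (Nat.factorial_ne_zero _)

theorem expFactorial_add_single_one {n : ℕ} (κ : Fin n →₀ ℕ) (i : Fin n) :
    expFactorial (κ + Finsupp.single i 1) = expFactorial κ * (κ i + 1) := by
  rw [expFactorial, expFactorial, ← Finset.mul_prod_erase _ _ (Finset.mem_univ i),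
    ← Finset.mul_prod_erase _ (fun j => ((κ j).factorial : ℂ)) (Finset.mem_univ i)]
  have : ∏ j ∈ Finset.univ.erase i, (((κ + Finsupp.single i 1 : Fin n →₀ ℕ) j).factorial : ℂ) =
      ∏ j ∈ Finset.univ.erase i, ((κ j).factorial : ℂ) := by
    refine Finset.prod_congr rfl fun j hj => ?_
    simp [(Finset.ne_of_mem_erase hj).symm]
  rw [this, Finsupp.add_apply, Finsupp.single_eq_same, Nat.factorial_succ]
  push_cast
  ring

theorem expFactorial_mul_coeff_pderiv_pow {n : ℕ} (i : Fin n) (k : ℕ)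
    (P : MvPolynomial (Fin n) ℂ) (κ : Fin n →₀ ℕ) :
    expFactorial κ * coeff κ ((((pderiv (R := ℂ) i).toLinearMap :
        Module.End ℂ (MvPolynomial (Fin n) ℂ)) ^ k) P) =
      expFactorial (κ + Finsupp.single i k) * coeff (κ + Finsupp.single i k) P := by
  induction k generalizing P κ with
  | zero => simp
  | succ k ih =>
    rw [pow_succ, Module.End.mul_apply, ih, Finsupp.single_add, ← add_assoc,
      expFactorial_add_single_one]
    have : coeff (κ + Finsupp.single i k) ((pderiv (R := ℂ) i).toLinearMap P) =
        coeff (κ + Finsupp.single i k + Finsupp.single i 1) P *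
          ((κ + Finsupp.single i k) i + 1 : ℂ) := by
      exact coeff_pderiv P _
    rw [this]
    ring

theorem expFactorial_mul_coeff_prod {n : ℕ} (l : List (Fin n)) (ν : Fin n →₀ ℕ)
    (P : MvPolynomial (Fin n) ℂ) (κ : Fin n →₀ ℕ) :
    expFactorial κ * coeff κ ((l.map fun i => (((pderiv (R := ℂ) i).toLinearMap :
        Module.End ℂ (MvPolynomial (Fin n) ℂ)) ^ ν i)).prod P) =
      expFactorial (κ + (l.map fun i => Finsupp.single i (ν i)).sum) *
        coeff (κ + (l.map fun i => Finsupp.single i (ν i)).sum) P := by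
  induction l generalizing κ with
  | nil => simp
  | cons i l ih =>
    rw [List.map_cons, List.prod_cons, Module.End.mul_apply, expFactorial_mul_coeff_pderiv_pow, ih,
      List.map_cons, List.sum_cons, add_assoc]

/-- The linear functional `X^ν ↦ ν! · [X^ν] P`. -/
def pairing {n : ℕ} (P : MvPolynomial (Fin n) ℂ) : MvPolynomial (Fin n) ℂ →ₗ[ℂ] ℂ :=
  (basisMonomials (Fin n) ℂ).constr ℂ fun ν => expFactorial ν * coeff ν P

theorem pairing_monomial {n : ℕ} (P : MvPolynomial (Fin n) ℂ) (ν : Fin n →₀ ℕ) :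
    pairing P (monomial ν 1) = expFactorial ν * coeff ν P := by
  have : (monomial ν 1 : MvPolynomial (Fin n) ℂ) = basisMonomials (Fin n) ℂ ν := by
    rw [coe_basisMonomials]
  rw [pairing, this, Module.Basis.constr_basis]

theorem linearMap_ext_monomial {n : ℕ} {M : Type*} [AddCommMonoid M] [Module ℂ M]
    {φ ψ : MvPolynomial (Fin n) ℂ →ₗ[ℂ] M}
    (h : ∀ ν, φ (monomial ν 1) = ψ (monomial ν 1)) : φ = ψ := by
  refine (basisMonomials (Fin n) ℂ).ext fun ν => ?_
  rw [coe_basisMonomials]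
  exact h ν

/-- Differentiation by `Q` is adjoint to multiplication by `Q`. It turns the equations defining
`SCov` into orthogonality to the ideal. -/
theorem expFactorial_mul_coeff_diffOp {n : ℕ} (Q P : MvPolynomial (Fin n) ℂ) (κ : Fin n →₀ ℕ) :
    expFactorial κ * coeff κ (diffOp Q P) = pairing P (monomial κ 1 * Q) := by
  have hlin : expFactorial κ • (lcoeff ℂ κ ∘ₗ LinearMap.applyₗ P ∘ₗ diffOp) =
      pairing P ∘ₗ LinearMap.mulLeft ℂ (monomial κ 1) := by
    refine linearMap_ext_monomial fun ν => ?_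
    have hν : (monomial ν 1 : MvPolynomial (Fin n) ℂ) = basisMonomials (Fin n) ℂ ν := by
      rw [coe_basisMonomials]
    have hd : diffOp (monomial ν 1 : MvPolynomial (Fin n) ℂ) =
        ((List.finRange n).map fun i => (((pderiv (R := ℂ) i).toLinearMap :
          Module.End ℂ (MvPolynomial (Fin n) ℂ)) ^ ν i)).prod := by
      rw [hν, diffOp, Module.Basis.constr_basis, List.ofFn_eq_map]
    have hs : ((List.finRange n).map fun i => Finsupp.single i (ν i)).sum = ν := by
      rw [← List.ofFn_eq_map, List.sum_ofFn]
      exact Finsupp.univ_sum_single ν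
    have := expFactorial_mul_coeff_prod (List.finRange n) ν P κ
    rw [hs, ← hd] at this
    simp only [LinearMap.smul_apply, LinearMap.comp_apply, LinearMap.applyₗ_apply_apply,
      lcoeff_apply, LinearMap.mulLeft_apply, monomial_mul, one_mul, pairing_monomial, smul_eq_mul]
    exact this
  exact LinearMap.congr_fun hlin Q

theorem mem_SCov_iff {n m : ℕ} {P : MvPolynomial (Fin n) ℂ} :
    P ∈ SCov n m ↔ ∀ Q ∈ QInvPlus n m, ∀ κ, pairing P (monomial κ 1 * Q) = 0 := by
  refine forall₂_congr fun Q _ => ⟨fun h κ => ?_, fun h => ?_⟩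
  · rw [← expFactorial_mul_coeff_diffOp, h, coeff_zero, mul_zero]
  · ext κ
    have := h κ
    rw [← expFactorial_mul_coeff_diffOp] at this
    exact (mul_eq_zero.1 this).resolve_left (expFactorial_ne_zero κ)

theorem pairing_eq_zero_of_mem_span {n m : ℕ} {P : MvPolynomial (Fin n) ℂ} (hP : P ∈ SCov n m)
    {f : MvPolynomial (Fin n) ℂ} (hf : f ∈ Ideal.span (QInvPlus n m)) : pairing P f = 0 := by
  have : ∀ c, pairing P (c * f) = 0 := by
    induction hf using Submodule.span_induction with
    | mem f h =>
      intro c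
      induction c using MvPolynomial.induction_on' with
      | monomial κ a =>
        have : (monomial κ a : MvPolynomial (Fin n) ℂ) = a • monomial κ 1 := by
          rw [smul_monomial, smul_eq_mul, mul_one]
        rw [this, smul_mul_assoc, map_smul, mem_SCov_iff.1 hP f h κ, smul_zero]
      | add p q hp hq => rw [add_mul, map_add, hp, hq, add_zero]
    | zero => simp
    | add f g _ _ hf hg => intro c; rw [mul_add, map_add, hf, hg, add_zero]
    | smul a f _ hf => intro c; rw [smul_eq_mul, ← mul_assoc, hf]
  simpa using this 1

/-- The degree is the sum of the list of nonzero exponents, so truncating by degree respects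
quasi-symmetry. Hence the ideal is homogeneous. -/
theorem homogeneousComponent_mem_QInvPlus {n m : ℕ} (hm : m ≠ 0) {Q : MvPolynomial (Fin n) ℂ}
    (hQ : Q ∈ QInvPlus n m) (k : ℕ) : homogeneousComponent k Q ∈ QInvPlus n m := by
  obtain ⟨h1, h2⟩ := (mem_QInv_iff hm).1 hQ.1
  refine ⟨(mem_QInv_iff hm).2 ⟨fun ν ν' h => ?_, fun ν hν => h2 ν fun h0 => hν ?_⟩, ?_⟩
  · rw [coeff_homogeneousComponent, coeff_homogeneousComponent, h1 ν ν' h, ← sum_expList,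
      ← sum_expList, h]
  · rw [coeff_homogeneousComponent, h0, ite_self]
  · have := hQ.2
    rw [constantCoeff_eq] at this ⊢
    rw [coeff_homogeneousComponent, this, ite_self]

theorem homogeneousComponent_monomial_one {n : ℕ} (k : ℕ) (ν : Fin n →₀ ℕ) :
    homogeneousComponent k (monomial ν 1 : MvPolynomial (Fin n) ℂ) =
      if ν.degree = k then monomial ν 1 else 0 := by
  ext κ
  rw [coeff_homogeneousComponent, coeff_monomial]
  by_cases h : ν = κ
  · subst h
    split_ifs <;> simp_all
  · split_ifs <;> simp [h]

theorem homogeneousComponent_monomial_mul {n : ℕ} (k : ℕ) (κ : Fin n →₀ ℕ)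
    (Q : MvPolynomial (Fin n) ℂ) :
    homogeneousComponent k (monomial κ 1 * Q) =
      if κ.degree ≤ k then monomial κ 1 * homogeneousComponent (k - κ.degree) Q else 0 := by
  have hlin : homogeneousComponent k ∘ₗ LinearMap.mulLeft ℂ (monomial κ (1 : ℂ)) =
      (if κ.degree ≤ k then LinearMap.mulLeft ℂ (monomial κ (1 : ℂ)) ∘ₗ
        homogeneousComponent (k - κ.degree) else 0) := by
    refine linearMap_ext_monomial fun ν => ?_
    rw [LinearMap.comp_apply, LinearMap.mulLeft_apply, monomial_mul, one_mul,
      homogeneousComponent_monomial_one, map_add]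
    by_cases h : κ.degree ≤ k
    · rw [if_pos h, LinearMap.comp_apply, LinearMap.mulLeft_apply,
        homogeneousComponent_monomial_one]
      by_cases h' : ν.degree = k - κ.degree
      · rw [if_pos h', if_pos (by omega), monomial_mul, one_mul]
      · rw [if_neg h', if_neg (by omega), mul_zero]
    · rw [if_neg h, if_neg (by omega), LinearMap.zero_apply]
  have := LinearMap.congr_fun hlin Q
  rw [LinearMap.comp_apply, LinearMap.mulLeft_apply] at this
  rw [this]
  split_ifs <;> rfl

open Classical in
/-- The exponents of degree `k` that give ballot vectors when divided by `m`. -/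
def ballotExps (n m k : ℕ) : Finset (Fin n →₀ ℕ) :=
  (Finset.univ.finsuppAntidiag k).filter fun ν => Ballot 0 (divExp m ν)

theorem degree_eq_univ_sum {n : ℕ} (ν : Fin n →₀ ℕ) : ν.degree = ∑ i, ν i :=
  Finset.sum_subset (Finset.subset_univ _) fun _ _ hi => Finsupp.notMem_support_iff.1 hi

theorem mem_ballotExps {n m k : ℕ} {ν : Fin n →₀ ℕ} :
    ν ∈ ballotExps n m k ↔ ν.degree = k ∧ Ballot 0 (divExp m ν) := by
  classical
  rw [ballotExps, Finset.mem_filter, Finset.mem_finsuppAntidiag, degree_eq_univ_sum]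
  simp

/-- A super-coinvariant is a functional vanishing on the ideal, hence determined by its values on a
complement. Reading off the coefficients at the ballot exponents of degree `k` is therefore an
isomorphism. -/
theorem finrank_SCov_inf_homogeneousSubmodule (n : ℕ) {m : ℕ} (hm : m ≠ 0) (k : ℕ) :
    Module.finrank ℂ (SCov n m ⊓ homogeneousSubmodule (Fin n) ℂ k :
      Submodule ℂ (MvPolynomial (Fin n) ℂ)) = (ballotExps n m k).card := by
  have hcompl := isCompl_span_QInvPlus_ballotSpanDiv n hm
  let Φ : (SCov n m ⊓ homogeneousSubmodule (Fin n) ℂ k :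
      Submodule ℂ (MvPolynomial (Fin n) ℂ)) →ₗ[ℂ] (ballotExps n m k → ℂ) :=
    (LinearMap.pi fun ν => lcoeff ℂ ν.1) ∘ₗ Submodule.subtype _
  have hΦ : ∀ P ν, Φ P ν = coeff ν.1 P.1 := fun _ _ => rfl
  have hinj : Function.Injective Φ := by
    rw [← LinearMap.ker_eq_bot, LinearMap.ker_eq_bot']
    rintro ⟨P, hP, hk⟩ h0
    have hzero : pairing P = 0 := by
      have htop : (⊤ : Submodule ℂ (MvPolynomial (Fin n) ℂ)) ≤ LinearMap.ker (pairing P) := by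
        rw [← hcompl.sup_eq_top]
        refine sup_le (Submodule.span_le.2 ?_) fun f hf => pairing_eq_zero_of_mem_span hP hf
        rintro _ ⟨ν, hν, rfl⟩
        rw [SetLike.mem_coe, LinearMap.mem_ker, pairing_monomial]
        by_cases hd : ν.degree = k
        · have := congrFun h0 ⟨ν, mem_ballotExps.2 ⟨hd, hν⟩⟩
          rw [hΦ] at this
          rw [this, Pi.zero_apply, mul_zero]
        · rw [((mem_homogeneousSubmodule _ _).1 hk).coeff_eq_zero hd, mul_zero]
      exact LinearMap.ker_eq_top.1 (top_le_iff.1 htop)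
    ext ν
    have := pairing_monomial P ν
    rw [hzero, LinearMap.zero_apply] at this
    simpa using (mul_eq_zero.1 this.symm).resolve_left (expFactorial_ne_zero ν)
  have hsurj : Function.Surjective Φ := by
    classical
    intro c
    obtain ⟨θ, hθI, hθB⟩ : ∃ θ : MvPolynomial (Fin n) ℂ →ₗ[ℂ] ℂ,
        (∀ f ∈ Ideal.span (QInvPlus n m), θ f = 0) ∧
        ∀ ν : ballotExps n m k, θ (monomial ν.1 1) = expFactorial ν.1 * c ν := by
      let ψ : MvPolynomial (Fin n) ℂ →ₗ[ℂ] ℂ := (basisMonomials (Fin n) ℂ).constr ℂ fun ν =>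
        if h : ν ∈ ballotExps n m k then expFactorial ν * c ⟨ν, h⟩ else 0
      -- Projecting along the ideal before applying `ψ` makes the functional vanish on the ideal
      -- without changing its values on the ballot monomials.
      refine ⟨ψ ∘ₗ Submodule.subtype _ ∘ₗ Submodule.projectionOnto _ _ hcompl,
        fun f hf => ?_, fun ν => ?_⟩
      · rw [LinearMap.comp_apply, LinearMap.comp_apply,
          (Submodule.projectionOnto_apply_eq_zero_iff hcompl).2 hf, map_zero, map_zero]
      · have hmem : (monomial ν.1 1 : MvPolynomial (Fin n) ℂ) ∈ ballotSpanDiv n m :=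
          Submodule.subset_span ⟨_, (mem_ballotExps.1 ν.2).2, rfl⟩
        have hb : (monomial ν.1 1 : MvPolynomial (Fin n) ℂ) = basisMonomials (Fin n) ℂ ν.1 := by
          rw [coe_basisMonomials]
        rw [LinearMap.comp_apply, LinearMap.comp_apply,
          Submodule.projectionOnto_apply_left hcompl ⟨_, hmem⟩, Submodule.subtype_apply]
        change ψ (monomial ν.1 1) = _
        rw [hb, Module.Basis.constr_basis, dif_pos ν.2]
    let P : MvPolynomial (Fin n) ℂ := ∑ ν ∈ Finset.univ.finsuppAntidiag k,
      monomial ν ((expFactorial ν)⁻¹ * θ (monomial ν 1))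
    have hcoeff : ∀ ν, coeff ν P =
        if ν.degree = k then (expFactorial ν)⁻¹ * θ (monomial ν 1) else 0 := by
      intro ν
      rw [coeff_sum]
      simp only [coeff_monomial, Finset.sum_ite_eq', Finset.mem_finsuppAntidiag,
        degree_eq_univ_sum, Finset.subset_univ, and_true]
    -- `P` represents only the degree `k` part of `θ`; homogeneity of the ideal ensures that this
    -- part still vanishes on it.
    have hpair : pairing P = θ ∘ₗ homogeneousComponent k := by
      refine linearMap_ext_monomial fun ν => ?_
      rw [pairing_monomial, hcoeff, LinearMap.comp_apply, homogeneousComponent_monomial_one]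
      split_ifs
      · rw [mul_inv_cancel_left₀ (expFactorial_ne_zero ν)]
      · rw [mul_zero, map_zero]
    have hS : P ∈ SCov n m := by
      refine mem_SCov_iff.2 fun Q hQ κ => ?_
      have hI : homogeneousComponent k (monomial κ 1 * Q) ∈
          Ideal.span (QInvPlus n m) := by
        rw [homogeneousComponent_monomial_mul]
        split_ifs
        · exact Ideal.mul_mem_left _ _
            (Ideal.subset_span (homogeneousComponent_mem_QInvPlus hm hQ _))
        · exact zero_mem _
      rw [hpair, LinearMap.comp_apply, hθI _ hI]
    have hH : P ∈ homogeneousSubmodule (Fin n) ℂ k := by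
      refine Submodule.sum_mem _ fun ν hν => isHomogeneous_monomial _ ?_
      rw [degree_eq_univ_sum]
      exact (Finset.mem_finsuppAntidiag.1 hν).1
    refine ⟨⟨P, hS, hH⟩, funext fun ν => ?_⟩
    rw [hΦ, hcoeff, if_pos (mem_ballotExps.1 ν.2).1, hθB,
      inv_mul_cancel_left₀ (expFactorial_ne_zero _)]
  rw [(LinearEquiv.ofBijective Φ ⟨hinj, hsurj⟩).finrank_eq, Module.finrank_fintype_fun_eq_card,
    Fintype.card_coe]

/-! ### Counting ballot vectors -/

theorem mem_ballotExps_one {n k : ℕ} {ν : Fin n →₀ ℕ} :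
    ν ∈ ballotExps n 1 k ↔ ν.degree = k ∧ Ballot 0 ν := by
  have : divExp 1 ν = ν := by
    ext i
    simp [divExp]
  rw [mem_ballotExps, this]

theorem Ballot.mono {n s : ℕ} {ν ν' : Fin n → ℕ} (h : Ballot s ν') (hle : ν ≤ ν') :
    Ballot s ν := by
  refine fun l => (Finset.sum_le_sum fun j _ => ?_).trans (h l)
  split_ifs
  · exact hle j
  · exact le_rfl

theorem Ballot.degree_le {n s : ℕ} {ν : Fin (n + 1) →₀ ℕ} (h : Ballot s ν) :
    ν.degree ≤ n + s := by
  refine le_trans (le_of_eq ?_) (h n)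
  rw [degree_eq_univ_sum]
  exact Finset.sum_congr rfl fun j _ => (if_pos (Nat.lt_succ_iff.1 j.2)).symm

theorem ballot_insertExp_last {n s : ℕ} {κ : Fin n →₀ ℕ} :
    Ballot s (insertExp (Fin.last n) κ) ↔ Ballot s κ := by
  refine forall_congr' fun l => ?_
  rw [Fin.sum_univ_castSucc, insertExp_self, ite_self, add_zero]
  simp only [← Fin.succAbove_last_apply, insertExp_succAbove]
  simp only [Fin.succAbove_last_apply, Fin.val_castSucc]

theorem degree_insertExp {n : ℕ} (i : Fin (n + 1)) (κ : Fin n →₀ ℕ) :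
    (insertExp i κ).degree = κ.degree := by
  rw [← sum_expList, insertExp, expList_embDomain, sum_expList]

/-- The last entry enters only the partial sums equal to the full degree, so the bound on the degree
is the only new condition. -/
theorem ballot_add_single_last {n k : ℕ} {ν : Fin (n + 1) →₀ ℕ} (hk : k + 1 ≤ n)
    (hd : ν.degree = k) (h : Ballot 0 ν) :
    Ballot 0 (ν + Finsupp.single (Fin.last n) 1 : Fin (n + 1) →₀ ℕ) := by
  intro l
  by_cases hl : n ≤ l
  · have : ∑ j : Fin (n + 1), (if j.val ≤ l then
        (ν + Finsupp.single (Fin.last n) 1 : Fin (n + 1) →₀ ℕ) j else 0) =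
        (ν + Finsupp.single (Fin.last n) 1 : Fin (n + 1) →₀ ℕ).degree := by
      rw [degree_eq_univ_sum]
      exact Finset.sum_congr rfl fun j _ => if_pos (by omega)
    rw [this, map_add, Finsupp.degree_single, hd]
    omega
  · refine le_trans (le_of_eq (Finset.sum_congr rfl fun j _ => ?_)) (h l)
    split_ifs with hj
    · have : j ≠ Fin.last n := by
        rintro rfl
        exact hl hj
      simp [this.symm]
    · rfl

theorem card_ballotExps_zero (n : ℕ) : (ballotExps n 1 0).card = 1 := by
  rw [Finset.card_eq_one]
  refine ⟨0, ?_⟩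
  ext ν
  rw [mem_ballotExps_one, Finset.mem_singleton, Finsupp.degree_eq_zero_iff]
  refine ⟨fun h => h.1, ?_⟩
  rintro rfl
  exact ⟨rfl, fun l => by simp⟩

/-- A nonzero last entry is lowered by one; a zero last entry is deleted. -/
theorem card_ballotExps_succ_succ {n k : ℕ} (hk : k + 1 ≤ n) :
    (ballotExps (n + 1) 1 (k + 1)).card =
      (ballotExps (n + 1) 1 k).card + (ballotExps n 1 (k + 1)).card := by
  classical
  rw [← Finset.card_filter_add_card_filter_not (s := ballotExps (n + 1) 1 (k + 1))
    (fun ν => ν (Fin.last n) ≠ 0)]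
  congr 1
  · refine Finset.card_nbij' (fun ν => ν - Finsupp.single (Fin.last n) 1)
      (fun ν => ν + Finsupp.single (Fin.last n) 1) ?_ ?_ ?_ ?_
    · intro ν hν
      obtain ⟨h, h0⟩ := Finset.mem_filter.1 hν
      obtain ⟨hd, hB⟩ := mem_ballotExps_one.1 h
      have hle : Finsupp.single (Fin.last n) 1 ≤ ν :=
        Finsupp.single_le_iff.2 (Nat.one_le_iff_ne_zero.2 h0)
      refine mem_ballotExps_one.2 ⟨?_, hB.mono ?_⟩
      · rw [← tsub_add_cancel_of_le hle, map_add, Finsupp.degree_single] at hd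
        exact Nat.succ_injective hd
      · exact tsub_le_self (a := ν)
    · intro ν hν
      obtain ⟨hd, hB⟩ := mem_ballotExps_one.1 hν
      refine Finset.mem_coe.2 (Finset.mem_filter.2
        ⟨mem_ballotExps_one.2 ⟨?_, ballot_add_single_last hk hd hB⟩, ?_⟩)
      · rw [map_add, Finsupp.degree_single, hd]
      · simp
    · intro ν hν
      exact tsub_add_cancel_of_le
        (Finsupp.single_le_iff.2 (Nat.one_le_iff_ne_zero.2 (Finset.mem_filter.1 hν).2))
    · intro ν _
      exact add_tsub_cancel_right _ _
  · refine Finset.card_nbij' (removeExp (Fin.last n)) (insertExp (Fin.last n)) ?_ ?_ ?_ ?_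
    · intro ν hν
      obtain ⟨h, h0⟩ := Finset.mem_filter.1 hν
      obtain ⟨hd, hB⟩ := mem_ballotExps_one.1 h
      rw [not_not] at h0
      rw [← insertExp_removeExp h0] at hd hB
      exact mem_ballotExps_one.2 ⟨by rwa [degree_insertExp] at hd, ballot_insertExp_last.1 hB⟩
    · intro κ hκ
      obtain ⟨hd, hB⟩ := mem_ballotExps_one.1 hκ
      exact Finset.mem_coe.2 (Finset.mem_filter.2 ⟨mem_ballotExps_one.2
        ⟨by rwa [degree_insertExp], ballot_insertExp_last.2 hB⟩,
        by rw [not_not, insertExp_self]⟩)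
    · intro ν hν
      exact insertExp_removeExp (not_not.1 (Finset.mem_filter.1 hν).2)
    · intro κ _
      exact removeExp_insertExp _ _

/-- The ballot numbers. -/
def ballotNumber (n k : ℕ) : ℚ := ((n : ℚ) - k) / ((n : ℚ) + k) * ((n + k).choose k : ℚ)

theorem ballotNumber_zero_right {n : ℕ} (hn : n ≠ 0) : ballotNumber n 0 = 1 := by
  have : (n : ℚ) ≠ 0 := Nat.cast_ne_zero.2 hn
  simp [ballotNumber, this]

theorem ballotNumber_self (n : ℕ) : ballotNumber n n = 0 := by simp [ballotNumber]

theorem ballotNumber_succ_succ (n k : ℕ) :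
    ballotNumber (n + 1) (k + 1) = ballotNumber (n + 1) k + ballotNumber n (k + 1) := by
  have h1 : ((n + (k + 1)).choose (k + 1) : ℚ) * (k + 1) = ((n + 1 + k).choose k : ℚ) * (n + 1) := by
    have := Nat.choose_succ_right_eq (n + k + 1) k
    rw [show n + k + 1 - k = n + 1 by omega] at this
    rw [show n + (k + 1) = n + k + 1 by omega, show n + 1 + k = n + k + 1 by omega]
    exact_mod_cast this
  have h2 : ((n + 1 + (k + 1)).choose (k + 1) : ℚ) =
      ((n + 1 + k).choose k : ℚ) + ((n + (k + 1)).choose (k + 1) : ℚ) := by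
    have := Nat.choose_succ_succ (n + k + 1) k
    rw [show n + (k + 1) = n + k + 1 by omega, show n + 1 + k = n + k + 1 by omega,
      show n + 1 + (k + 1) = n + k + 1 + 1 by omega]
    exact_mod_cast this
  have hk : (k + 1 : ℚ) ≠ 0 := by positivity
  rw [ballotNumber, ballotNumber, ballotNumber, h2, eq_div_of_mul_eq hk h1]
  have h3 : (n + 1 + (k + 1) : ℚ) ≠ 0 := by positivity
  have h4 : (n + 1 + k : ℚ) ≠ 0 := by positivity
  have h5 : (n + (k + 1) : ℚ) ≠ 0 := by positivity
  push_cast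
  field_simp
  ring

theorem ballotNumber_succ_self (n : ℕ) : ballotNumber (n + 1) n = catalan n := by
  have h1 : ((n + 1 : ℕ) : ℚ) * catalan n = (2 * n).choose n := by
    rw [← Nat.centralBinom_eq_two_mul_choose, ← succ_mul_catalan_eq_centralBinom]
    push_cast
    ring
  have h2 : (2 * n + 1 : ℚ) * (2 * n).choose n = (n + 1 + n).choose n * (n + 1) := by
    have := Nat.add_one_mul_choose_eq (2 * n) n
    rw [← Nat.choose_symm_of_eq_add (show 2 * n + 1 = n + (n + 1) by omega)] at this
    rw [show n + 1 + n = 2 * n + 1 by omega]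
    exact_mod_cast this
  rw [← h1] at h2
  rw [ballotNumber]
  have h3 : (n + 1 : ℚ) ≠ 0 := by positivity
  have h4 : (n + 1 + n : ℚ) ≠ 0 := by positivity
  push_cast at h2 ⊢
  rw [div_mul_eq_mul_div, div_eq_iff h4]
  apply mul_right_cancel₀ h3
  linear_combination -h2

/-- Both sides satisfy the same recursion. The range includes `k = n`, where both vanish, since the
recursion at `(n + 1, n)` refers to `(n, n)`. -/
theorem card_ballotExps {n k : ℕ} (hn : n ≠ 0) (hk : k ≤ n) :
    ((ballotExps n 1 k).card : ℚ) = ballotNumber n k := by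
  induction n generalizing k with
  | zero => exact absurd rfl hn
  | succ n ih =>
    rcases hk.eq_or_lt with rfl | hlt
    · rw [ballotNumber_self, Nat.cast_eq_zero, Finset.card_eq_zero,
        Finset.eq_empty_iff_forall_notMem]
      intro ν hν
      obtain ⟨hd, hB⟩ := mem_ballotExps_one.1 hν
      have := hB.degree_le
      omega
    · induction k with
      | zero => rw [card_ballotExps_zero, ballotNumber_zero_right hn, Nat.cast_one]
      | succ k IH =>
        rw [card_ballotExps_succ_succ (by omega), Nat.cast_add, IH (by omega) (by omega),
          ih (by omega) (by omega), ballotNumber_succ_succ]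

/-! ### The Hilbert series -/

theorem one_sub_X_pow_mul_inv (m : ℕ) :
    (1 - PowerSeries.X ^ m) * (1 - PowerSeries.X : ℚ⟦X⟧)⁻¹ =
      ∑ j ∈ Finset.range m, PowerSeries.X ^ j := by
  rw [← mul_neg_geom_sum, mul_right_comm, PowerSeries.mul_inv_cancel, one_mul]
  simp

theorem coeff_hilbertSeries {n m : ℕ} (hm : m ≠ 0) (k : ℕ) :
    PowerSeries.coeff k (hilbertSeries n m) = ((ballotExps n m k).card : ℚ) := by
  rw [hilbertSeries, PowerSeries.coeff_mk, finrank_SCov_inf_homogeneousSubmodule n hm]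

theorem degree_modExp_add {n : ℕ} (m : ℕ) (ν : Fin n →₀ ℕ) :
    ∑ i, modExp m ν i + m * (divExp m ν).degree = ν.degree := by
  rw [← degree_eq_univ_sum, ← smul_eq_mul, ← map_nsmul, ← map_add, modExp_add_smul_divExp]

theorem hilbertSeries_eq {n m : ℕ} (hn : n ≠ 0) (hm : m ≠ 0) :
    hilbertSeries n m = ((1 - PowerSeries.X ^ m) * (1 - PowerSeries.X : ℚ⟦X⟧)⁻¹) ^ n *
      ∑ k ∈ Finset.range n, PowerSeries.C (ballotNumber n k) * PowerSeries.X ^ (m * k) := by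
  classical
  obtain ⟨n, rfl⟩ := Nat.exists_eq_succ_of_ne_zero hn
  -- All ballot vectors: their degree is at most `n`, so there are finitely many.
  let B : Finset (Fin (n + 1) →₀ ℕ) := (Finset.range (n + 1)).biUnion (ballotExps (n + 1) 1)
  have hB : ∀ κ, κ ∈ B ↔ Ballot 0 κ := by
    intro κ
    simp only [B, Finset.mem_biUnion, Finset.mem_range, mem_ballotExps_one]
    exact ⟨fun ⟨_, _, _, h⟩ => h, fun h => ⟨κ.degree, by have := h.degree_le; omega, rfl, h⟩⟩
  have hsum : ∑ k ∈ Finset.range (n + 1),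
      PowerSeries.C (ballotNumber (n + 1) k) * PowerSeries.X ^ (m * k) =
      ∑ κ ∈ B, (PowerSeries.X : ℚ⟦X⟧) ^ (m * κ.degree) := by
    rw [Finset.sum_biUnion]
    · refine Finset.sum_congr rfl fun k hk => ?_
      rw [← card_ballotExps n.succ_ne_zero (Finset.mem_range.1 hk).le,
        Finset.sum_congr rfl fun κ hκ => by rw [(mem_ballotExps_one.1 hκ).1],
        Finset.sum_const, nsmul_eq_mul]
      simp
    · intro a _ b _ hab
      refine Finset.disjoint_left.2 fun κ ha hb => hab ?_
      rw [← (mem_ballotExps_one.1 ha).1, (mem_ballotExps_one.1 hb).1]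
  have hpow : (∑ j ∈ Finset.range m, (PowerSeries.X : ℚ⟦X⟧) ^ j) ^ (n + 1) =
      ∑ r ∈ Fintype.piFinset fun _ : Fin (n + 1) => Finset.range m,
        PowerSeries.X ^ (∑ i, r i) := by
    have := Finset.prod_univ_sum (fun _ : Fin (n + 1) => Finset.range m)
      (fun _ j => (PowerSeries.X : ℚ⟦X⟧) ^ j)
    rw [Finset.prod_const, Finset.card_univ, Fintype.card_fin] at this
    rw [this]
    exact Finset.sum_congr rfl fun r _ => Finset.prod_pow_eq_pow_sum _ _ _
  rw [one_sub_X_pow_mul_inv, hsum, hpow, Finset.sum_mul_sum, ← Finset.sum_product']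
  ext k
  rw [coeff_hilbertSeries hm, map_sum]
  simp only [← pow_add, PowerSeries.coeff_X_pow]
  rw [Finset.sum_boole]
  congr 1
  refine Finset.card_nbij' (fun ν => (⇑(modExp m ν), divExp m ν))
    (fun p => Finsupp.equivFunOnFinite.symm p.1 + m • p.2) ?_ ?_ ?_ ?_
  · intro ν hν
    obtain ⟨hd, hb⟩ := mem_ballotExps.1 hν
    refine Finset.mem_coe.2 (Finset.mem_filter.2 ⟨Finset.mem_product.2 ⟨?_, (hB _).2 hb⟩, ?_⟩)
    · rw [Fintype.mem_piFinset]
      exact fun i => Finset.mem_range.2 (modExp_lt hm ν i)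
    · rw [← hd]
      exact (degree_modExp_add m ν).symm
  · rintro ⟨r, κ⟩ hp
    obtain ⟨hp, hk⟩ := Finset.mem_filter.1 hp
    obtain ⟨hr, hκ⟩ := Finset.mem_product.1 hp
    have hr' : ∀ i, Finsupp.equivFunOnFinite.symm r i < m := fun i =>
      Finset.mem_range.1 (Fintype.mem_piFinset.1 hr i)
    refine mem_ballotExps.2 ⟨?_, ?_⟩
    · rw [← degree_modExp_add m, modExp_add_smul hr', divExp_add_smul hr']
      exact hk.symm
    · rw [divExp_add_smul hr']
      exact (hB _).1 hκ
  · intro ν _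
    refine Eq.trans ?_ (modExp_add_smul_divExp m ν)
    exact congrArg (· + m • divExp m ν) (Finsupp.ext fun _ => rfl)
  · rintro ⟨r, κ⟩ hp
    obtain ⟨hr, -⟩ := Finset.mem_product.1 (Finset.mem_filter.1 hp).1
    have hr' : ∀ i, Finsupp.equivFunOnFinite.symm r i < m := fun i =>
      Finset.mem_range.1 (Fintype.mem_piFinset.1 hr i)
    change (⇑(modExp m _), divExp m _) = _
    rw [modExp_add_smul hr', divExp_add_smul hr']
    rfl

/-! ### The generating function -/

/-- The additive recursion of the ballot numbers is multiplied by `q^(k+1)` and summed over `k < n`;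
the boundary values `0` at `(n, n)` and the Catalan number at `(n + 1, n)` leave a single term. At
`n = 0` the identity would require the empty sum to be `1`. -/
theorem sum_ballotNumber_recursion {A : Type*} [CommRing A] [Algebra ℚ A] (q : A) {n : ℕ}
    (hn : n ≠ 0) :
    (q - 1) * ∑ k ∈ Finset.range (n + 1), algebraMap ℚ A (ballotNumber (n + 1) k) * q ^ k +
      ∑ k ∈ Finset.range n, algebraMap ℚ A (ballotNumber n k) * q ^ k =
      q ^ (n + 1) * algebraMap ℚ A (catalan n) := by
  have h1 : ∑ k ∈ Finset.range (n + 1), algebraMap ℚ A (ballotNumber (n + 1) k) * q ^ k =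
      q * ∑ k ∈ Finset.range n, algebraMap ℚ A (ballotNumber (n + 1) k) * q ^ k +
        ∑ k ∈ Finset.range n, algebraMap ℚ A (ballotNumber n (k + 1)) * q ^ (k + 1) + 1 := by
    rw [Finset.sum_range_succ', ballotNumber_zero_right n.succ_ne_zero, Finset.mul_sum,
      ← Finset.sum_add_distrib]
    simp only [ballotNumber_succ_succ, map_add, map_one, pow_zero, mul_one, pow_succ]
    congr 1
    exact Finset.sum_congr rfl fun k _ => by ring
  have h2 : ∑ k ∈ Finset.range n, algebraMap ℚ A (ballotNumber n k) * q ^ k =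
      ∑ k ∈ Finset.range n, algebraMap ℚ A (ballotNumber n (k + 1)) * q ^ (k + 1) + 1 := by
    have h3 := Finset.sum_range_succ (fun k => algebraMap ℚ A (ballotNumber n k) * q ^ k) n
    rw [Finset.sum_range_succ', ballotNumber_self, ballotNumber_zero_right hn] at h3
    simpa using h3.symm
  have h4 : ∑ k ∈ Finset.range (n + 1), algebraMap ℚ A (ballotNumber (n + 1) k) * q ^ k =
      ∑ k ∈ Finset.range n, algebraMap ℚ A (ballotNumber (n + 1) k) * q ^ k +
        algebraMap ℚ A (catalan n) * q ^ n := by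
    rw [Finset.sum_range_succ, ballotNumber_succ_self]
  linear_combination q * h4 - h1 + h2

/-- The Catalan generating function evaluated at `a x`. -/
def catalanAt (a : ℚ⟦X⟧) : ℚ⟦X⟧⟦X⟧ :=
  PowerSeries.rescale a (PowerSeries.map (Nat.castRingHom _) PowerSeries.catalanSeries)

theorem coeff_catalanAt (a : ℚ⟦X⟧) (n : ℕ) :
    PowerSeries.coeff n (catalanAt a) = a ^ n * (catalan n : ℚ⟦X⟧) := by
  simp [catalanAt]

theorem catalanAt_sq (a : ℚ⟦X⟧) :
    catalanAt a ^ 2 * (PowerSeries.C a * PowerSeries.X) + 1 = catalanAt a := by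
  unfold catalanAt
  have h := congrArg (fun s => PowerSeries.rescale a
    (PowerSeries.map (Nat.castRingHom ℚ⟦X⟧) s)) PowerSeries.catalanSeries_sq_mul_X_add_one
  simpa only [map_add, map_mul, map_pow, map_one, PowerSeries.map_X, PowerSeries.rescale_X] using h

/-- The recursion for the ballot polynomials, multiplied by `(u x)^(n+1)` and summed over `n`. The
`- 1` on the right corrects the coefficient of `x`, where the recursion fails because the series has
no constant term. -/
theorem genFun_mul {m : ℕ} (hm : m ≠ 0) {q u : ℚ⟦X⟧} (hq : q = PowerSeries.X ^ m)
    (hu : u = (1 - PowerSeries.X ^ m) * (1 - PowerSeries.X : ℚ⟦X⟧)⁻¹) :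
    genFun m * (PowerSeries.C (q - 1) + PowerSeries.C u * PowerSeries.X) =
      PowerSeries.C u * PowerSeries.X * (PowerSeries.C q * catalanAt (q * u) - 1) := by
  have hH : ∀ n, PowerSeries.coeff (n + 1) (genFun m) = u ^ (n + 1) *
      ∑ k ∈ Finset.range (n + 1), algebraMap ℚ ℚ⟦X⟧ (ballotNumber (n + 1) k) * q ^ k := by
    intro n
    rw [genFun, PowerSeries.coeff_mk, if_neg n.succ_ne_zero, hilbertSeries_eq n.succ_ne_zero hm,
      hu, hq]
    simp only [pow_mul]
    rfl
  have h0 : PowerSeries.coeff 0 (genFun m) = 0 := by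
    rw [genFun, PowerSeries.coeff_mk, if_pos rfl]
  have hl : genFun m * (PowerSeries.C (q - 1) + PowerSeries.C u * PowerSeries.X) =
      PowerSeries.C (q - 1) * genFun m + PowerSeries.C u * (genFun m * PowerSeries.X) := by ring
  have hr : PowerSeries.C u * PowerSeries.X * (PowerSeries.C q * catalanAt (q * u) - 1) =
      PowerSeries.C (u * q) * (catalanAt (q * u) * PowerSeries.X) -
        PowerSeries.C u * PowerSeries.X := by
    rw [map_mul]
    ring
  rw [hl, hr]
  ext1 n
  rw [map_add (PowerSeries.coeff n), map_sub (PowerSeries.coeff n), PowerSeries.coeff_C_mul,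
    PowerSeries.coeff_C_mul, PowerSeries.coeff_C_mul, PowerSeries.coeff_C_mul]
  cases n with
  | zero => simp [h0]
  | succ n =>
    rw [PowerSeries.coeff_succ_mul_X, PowerSeries.coeff_succ_mul_X, hH, coeff_catalanAt]
    cases n with
    | zero =>
      rw [h0, Finset.sum_range_one, ballotNumber_zero_right (Nat.succ_ne_zero 0)]
      simp
      ring
    | succ n =>
      rw [hH, PowerSeries.coeff_X, if_neg (by omega)]
      have := sum_ballotNumber_recursion q (n := n + 1) (by omega)
      rw [map_natCast] at this
      linear_combination u ^ (n + 1 + 1) * this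

end QuasiInv

end

theorem mainTheorem4 (m : ℕ) (hm : 1 ≤ m) :
    (∀ n : ℕ, 1 ≤ n →
      QuasiInv.hilbertSeries n m =
          ((1 - PowerSeries.X ^ m) * (1 - PowerSeries.X : ℚ⟦X⟧)⁻¹) ^ n *
            (((QuasiInv.F n).comp (Polynomial.X ^ m) : ℚ[X]) : ℚ⟦X⟧) ∧
      QuasiInv.hilbertSeries n m =
          ((1 - PowerSeries.X ^ m) * (1 - PowerSeries.X : ℚ⟦X⟧)⁻¹) ^ n *
            ∑ k ∈ Finset.range n,
              PowerSeries.C (((n : ℚ) - k) / ((n : ℚ) + k) * ((n + k).choose k : ℚ)) *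
                PowerSeries.X ^ (m * k)) ∧
    (∃ S : ℚ⟦X⟧⟦X⟧,
      (∀ S' : ℚ⟦X⟧⟦X⟧,
        QuasiInv.IsSqrt S'
            ((1 - QuasiInv.t) *
              (1 - QuasiInv.t - 4 * QuasiInv.t ^ m * QuasiInv.x * (1 - QuasiInv.t ^ m))) ↔
          S' = S) ∧
      IsUnit (2 * ((1 - QuasiInv.t) * (QuasiInv.t ^ m - 1) +
          QuasiInv.x * (1 - QuasiInv.t ^ m))) ∧
      QuasiInv.genFun m *
          (2 * ((1 - QuasiInv.t) * (QuasiInv.t ^ m - 1) +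
            QuasiInv.x * (1 - QuasiInv.t ^ m))) =
        (1 - QuasiInv.t) - S - 2 * QuasiInv.x * (1 - QuasiInv.t ^ m)) := by
  have hm0 : m ≠ 0 := by omega
  refine ⟨fun n hn => ?_, ?_⟩
  · have h := QuasiInv.hilbertSeries_eq (n := n) (by omega) hm0
    refine ⟨?_, h⟩
    rw [h]
    congr 1
    rw [QuasiInv.F, Polynomial.sum_comp, ← Polynomial.coeToPowerSeries.ringHom_apply,
      map_sum]
    refine Finset.sum_congr rfl fun k _ => ?_
    rw [Polynomial.mul_comp, Polynomial.C_comp, Polynomial.pow_comp, Polynomial.X_comp, ← pow_mul,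
      Polynomial.coeToPowerSeries.ringHom_apply, Polynomial.coe_mul, Polynomial.coe_C,
      Polynomial.coe_pow, Polynomial.coe_X]
    rfl
  · obtain ⟨q, hq⟩ : ∃ q : ℚ⟦X⟧, q = PowerSeries.X ^ m := ⟨_, rfl⟩
    obtain ⟨u, hu⟩ : ∃ u : ℚ⟦X⟧, u = (1 - PowerSeries.X ^ m) * (1 - PowerSeries.X : ℚ⟦X⟧)⁻¹ :=
      ⟨_, rfl⟩
    have htm : QuasiInv.t ^ m = PowerSeries.C q := by
      rw [QuasiInv.t, ← map_pow, hq]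
    have hut : (1 - QuasiInv.t) * PowerSeries.C u = 1 - PowerSeries.C q := by
      have : (1 - PowerSeries.X) * u = 1 - q := by
        rw [hu, hq, mul_left_comm, PowerSeries.mul_inv_cancel, mul_one]
        simp
      rw [← map_one PowerSeries.C, QuasiInv.t, ← map_sub, ← map_sub, ← map_mul, this]
    have hgen := QuasiInv.genFun_mul hm0 hq hu
    have hcat := QuasiInv.catalanAt_sq (q * u)
    have hx : (PowerSeries.X : ℚ⟦X⟧⟦X⟧) = QuasiInv.x := rfl
    rw [hx, map_sub, map_one] at hgen
    rw [hx, map_mul] at hcat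
    rw [htm]
    set c := QuasiInv.catalanAt (q * u)
    set T := QuasiInv.t with hT
    set Q : ℚ⟦X⟧⟦X⟧ := PowerSeries.C q with hQ
    set U : ℚ⟦X⟧⟦X⟧ := PowerSeries.C u
    -- With `z = q u x`, the equation `c = 1 + z c^2` gives `(1 - 2 z c)^2 = 1 - 4 z`; the factor `1
    -- - t` clears the denominator of `u`.
    have hS2 : ((1 - T) * (1 - 2 * (Q * U * QuasiInv.x * c))) ^ 2 =
        (1 - T) * (1 - T - 4 * Q * QuasiInv.x * (1 - Q)) := by
      rw [← hut]
      linear_combination 4 * (1 - T) ^ 2 * Q * U * QuasiInv.x * hcat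
    have hS0 : PowerSeries.constantCoeff (PowerSeries.constantCoeff
        ((1 - T) * (1 - 2 * (Q * U * QuasiInv.x * c)))) = 1 := by
      simp [hT, QuasiInv.t, QuasiInv.x]
    refine ⟨(1 - T) * (1 - 2 * (Q * U * QuasiInv.x * c)), fun S' => ⟨?_, ?_⟩, ?_, ?_⟩
    · rintro ⟨h2, h1⟩
      rcases sq_eq_sq_iff_eq_or_eq_neg.1 (h2.trans hS2.symm) with h | h
      · exact h
      · rw [h, map_neg, map_neg, hS0] at h1
        norm_num at h1
    · rintro rfl
      exact ⟨hS2, hS0⟩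
    -- The constant term in both variables is `-2`, because `m ≠ 0` makes `t^m` vanish at `t = 0`.
    · rw [PowerSeries.isUnit_iff_constantCoeff, PowerSeries.isUnit_iff_constantCoeff]
      simp [hT, hQ, hq, QuasiInv.t, QuasiInv.x, hm0, map_ofNat]
    · linear_combination 2 * (1 - T) * hgen - 2 * QuasiInv.genFun m * QuasiInv.x * hut -
        2 * QuasiInv.x * hut
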